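/- **Setting.** Let $\mathcal E$ be a closed symmetric monoidal category, with tensor product $\otimes$, unit $I$ and initial object $\emptyset$, equipped with a Quillen model structure satisfying the pushout-product axiom: for cofibrations $i:A\to B$ and $j:X\to Y$ the pushout-product $B\otimes X\cup_{A\otimes X}A\otimes Y\to B\otimes Y$ is a cofibration, and it is a weak equivalence if $i$ or $j$ is one. (For instance, $\mathcal E$ is any monoidal model category.) For a group $G$, a *$G$-cofibration* is a $G$-equivariant morphism between objects of $\mathcal E$ with $G$-action which has the left lifting property with respect to all $G$-equivariant morphisms whose underlying morphism in $\mathcal E$ is a trivial fibration. A *collection* $\mathcal K$ is a sequence $(\mathcal K(n))_{n\ge 0}$ of objects of $\mathcal E$, where $\mathcal K(n)$ carries an action of the symmetric group $\Sigma_n$. A morphism of collections is a *cofibration of collections* if it is a $\Sigma_n$-cofibration in each degree $n$. Let $\underline I$ be the collection with $\underline I(1)=I$ and $\underline I(n)=\emptyset$ for $n\neq 1$. **Trees.** A coloured tree $(T,c)$ is a finite rooted planar tree, each of whose vertices has finitely many (possibly zero) inputs and is declared to be coloured or uncoloured. We write $|$ for the tree without vertices. Every other tree has a root vertex, with $n\ge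 0$ inputs, onto which coloured trees $(T_1,c_1),\dots,(T_n,c_n)$ are grafted. $\mathrm{Aut}(T,c)$ is the group of automorphisms of $(T,c)$ as a rooted tree with coloured vertices; these need not respect the planar structure. **The construction.** Let $\underline I\xrightarrow{\ \eta\ }\mathcal K_1\xrightarrow{\ u\ }\mathcal K_2$ be morphisms of collections. Put $\underline u(|)=I$ and $\underline u^*(|)=\emptyset$. For $T\ne|$ as above, let $$\underline v(T,c)=\underline u(T_1,c_1)\otimes\cdots\otimes\underline u(T_n,c_n),\qquad \underline v^*(T,c)=\bigcup_{i=1}^n\underline u(T_1,c_1)\otimes\cdots\otimes\underline u^*(T_i,c_i)\otimes\cdots\otimes\underline u(T_n,c_n),$$ $$\underline u(T,c)=\begin{cases}\mathcal K_1(n)\otimes\underline v(T,c)&\text{if the root is uncoloured},\\ \mathcal K_2(n)\otimes\underline v(T,c)&\text{if the root is coloured},\end{cases}$$ $$\underline u^*(T,c)=\begin{cases}\mathcal K_1(n)\otimes\underline v^*(T,c)&\text{if the root is uncoloured, not unary},\\ \mathcal K_1(1)\otimes\underline v^*(T,c)\cup I\otimes\underline v(T,c)&\text{if the root is uncoloured,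 unary},\\ \mathcal K_2(n)\otimes\underline v^*(T,c)\cup\mathcal K_1(n)\otimes\underline v(T,c)&\text{if the root is coloured}.\end{cases}$$ The unions denote the domains of (iterated) pushout-products: $\underline v^*\to\underline v$ is the pushout-product of the $n$ morphisms $\underline u^*(T_i,c_i)\to\underline u(T_i,c_i)$ (it is $\emptyset\to I$ if $n=0$), and $\underline u^*(T,c)\to\underline u(T,c)$ is the pushout-product of $\underline v^*\to\underline v$ with $\eta(n):\underline I(n)\to\mathcal K_1(n)$ if the root is uncoloured, and with $u(n):\mathcal K_1(n)\to\mathcal K_2(n)$ if the root is coloured. The group $\mathrm{Aut}(T,c)$ acts compatibly on $\underline u^*(T,c)$ and $\underline u(T,c)$: the permutation of the inputs which an automorphism induces at a vertex acts through the $\Sigma_n$-actions of the collections, and through the symmetry of $\otimes$ on the factors belonging to the subtrees. **Lemma.** Assume that $\eta:\underline I\to\mathcal K_1$ and $u:\mathcal K_1\to\mathcal K_2$ are cofibrations of collections. Then for every coloured tree $(T,c)$ with at least one vertex, and also for $T=|$ if the unit $I$ is cofibrant, the morphism $\underline u^*(T,c)\to\underline u(T,c)$ is an $\mathrm{Aut}(T,c)$-cofibration.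 -/

import Mathlib

open CategoryTheory MonoidalCategory Limits
universe v u w
set_option linter.unusedSectionVars false
namespace PushoutProduct
noncomputable section
variable {C : Type u} [Category.{v} C] [MonoidalCategory C] [HasPushouts C]
variable {A B X Y S T U V : C}

section Basic
/-- The domain `B ⊗ X ∪ A ⊗ Y` (pushout over `A ⊗ X`) of the pushout-product of `f : A ⟶ B` and
`g : X ⟶ Y`. -/
def dom (f : A ⟶ B) (g : X ⟶ Y) : C := pushout (f ▷ X) (A ◁ g)

def inl (f : A ⟶ B) (g : X ⟶ Y) : B ⊗ X ⟶ dom f g := pushout.inl _ _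
def inr (f : A ⟶ B) (g : X ⟶ Y) : A ⊗ Y ⟶ dom f g := pushout.inr _ _
variable (f : A ⟶ B) (g : X ⟶ Y)
lemma isPushout : IsPushout (f ▷ X) (A ◁ g) (inl f g) (inr f g) :=
  IsPushout.of_hasPushout _ _

lemma cond : f ▷ X ≫ inl f g = A ◁ g ≫ inr f g := (isPushout f g).w

variable {f g}
lemma hom_ext {a b : dom f g ⟶ T} (h₁ : inl f g ≫ a = inl f g ≫ b)
    (h₂ : inr f g ≫ a = inr f g ≫ b) : a = b := (isPushout f g).hom_ext h₁ h₂

def desc (a : B ⊗ X ⟶ T) (b : A ⊗ Y ⟶ T) (h : f ▷ X ≫ a = A ◁ g ≫ b) : dom f g ⟶ T :=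
  (isPushout f g).desc a b h

section
variable (a : B ⊗ X ⟶ T) (b : A ⊗ Y ⟶ T) (h : f ▷ X ≫ a = A ◁ g ≫ b)
@[simp] lemma inl_desc : inl f g ≫ desc a b h = a := (isPushout f g).inl_desc a b h
@[simp] lemma inr_desc : inr f g ≫ desc a b h = b := (isPushout f g).inr_desc a b h
@[simp] lemma inl_desc_assoc (k : T ⟶ V) : inl f g ≫ desc a b h ≫ k = a ≫ k := by
  rw [← Category.assoc, inl_desc]
@[simp] lemma inr_desc_assoc (k : T ⟶ V) : inr f g ≫ desc a b h ≫ k = b ≫ k := by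
  rw [← Category.assoc, inr_desc]
end

variable (f g)
/-- The pushout-product `B ⊗ X ∪ A ⊗ Y ⟶ B ⊗ Y` of `f : A ⟶ B` and `g : X ⟶ Y`. -/
def ι : dom f g ⟶ B ⊗ Y := desc (B ◁ g) (f ▷ Y) (whisker_exchange _ _).symm

@[simp] lemma inl_ι : inl f g ≫ ι f g = B ◁ g := inl_desc _ _ _
@[simp] lemma inr_ι : inr f g ≫ ι f g = f ▷ Y := inr_desc _ _ _
@[simp] lemma inl_ι_assoc (k : B ⊗ Y ⟶ T) : inl f g ≫ ι f g ≫ k = B ◁ g ≫ k := by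
  rw [← Category.assoc, inl_ι]
@[simp] lemma inr_ι_assoc (k : B ⊗ Y ⟶ T) : inr f g ≫ ι f g ≫ k = f ▷ Y ≫ k := by
  rw [← Category.assoc, inr_ι]
end Basic

section Map
variable {A' B' X' Y' : C} {f : A ⟶ B} {f' : A' ⟶ B'} {g : X ⟶ Y} {g' : X' ⟶ Y'}
def map (l : A ⟶ A') (r : B ⟶ B') (w : l ≫ f' = f ≫ r) (l' : X ⟶ X') (r' : Y ⟶ Y')
    (w' : l' ≫ g' = g ≫ r') : dom f g ⟶ dom f' g' :=
  desc ((r ⊗ₘ l') ≫ inl f' g') ((l ⊗ₘ r') ≫ inr f' g') (by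
    have e1 : f ▷ X ≫ (r ⊗ₘ l') = (l ⊗ₘ l') ≫ f' ▷ X' := by
      rw [← tensorHom_id, ← tensorHom_id, tensorHom_comp_tensorHom, tensorHom_comp_tensorHom, w,
        Category.id_comp, Category.comp_id]
    have e2 : A ◁ g ≫ (l ⊗ₘ r') = (l ⊗ₘ l') ≫ A' ◁ g' := by
      rw [← id_tensorHom, ← id_tensorHom, tensorHom_comp_tensorHom, tensorHom_comp_tensorHom, w',
        Category.id_comp, Category.comp_id]
    rw [← Category.assoc, e1, ← Category.assoc, e2, Category.assoc, cond, Category.assoc])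
variable (l : A ⟶ A') (r : B ⟶ B') (w : l ≫ f' = f ≫ r) (l' : X ⟶ X') (r' : Y ⟶ Y')
    (w' : l' ≫ g' = g ≫ r')
@[simp] lemma inl_map : inl f g ≫ map l r w l' r' w' = (r ⊗ₘ l') ≫ inl f' g' := inl_desc _ _ _
@[simp] lemma inr_map : inr f g ≫ map l r w l' r' w' = (l ⊗ₘ r') ≫ inr f' g' := inr_desc _ _ _
@[simp] lemma inl_map_assoc (k : dom f' g' ⟶ T) :
    inl f g ≫ map l r w l' r' w' ≫ k = (r ⊗ₘ l') ≫ inl f' g' ≫ k := by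
  rw [← Category.assoc, inl_map, Category.assoc]
@[simp] lemma inr_map_assoc (k : dom f' g' ⟶ T) :
    inr f g ≫ map l r w l' r' w' ≫ k = (l ⊗ₘ r') ≫ inr f' g' ≫ k := by
  rw [← Category.assoc, inr_map, Category.assoc]
lemma map_ι : map l r w l' r' w' ≫ ι f' g' = ι f g ≫ (r ⊗ₘ r') := by
  apply hom_ext
  · rw [inl_map_assoc, inl_ι, inl_ι_assoc, ← id_tensorHom, ← id_tensorHom,
      tensorHom_comp_tensorHom, tensorHom_comp_tensorHom, w', Category.comp_id, Category.id_comp]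
  · rw [inr_map_assoc, inr_ι, inr_ι_assoc, ← tensorHom_id, ← tensorHom_id,
      tensorHom_comp_tensorHom, tensorHom_comp_tensorHom, w, Category.comp_id, Category.id_comp]
lemma map_comp {A'' B'' X'' Y'' : C} {f'' : A'' ⟶ B''} {g'' : X'' ⟶ Y''}
    (m : A' ⟶ A'') (s : B' ⟶ B'') (x : m ≫ f'' = f' ≫ s) (m' : X' ⟶ X'') (s' : Y' ⟶ Y'')
    (x' : m' ≫ g'' = g' ≫ s') :
    map l r w l' r' w' ≫ map m s x m' s' x' =
      map (l ≫ m) (r ≫ s) (by rw [Category.assoc, x, ← Category.assoc, w, Category.assoc])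
        (l' ≫ m') (r' ≫ s')
        (by rw [Category.assoc, x', ← Category.assoc, w', Category.assoc]) := by
  apply hom_ext <;> simp

lemma map_id : map (f := f) (g := g) (𝟙 A) (𝟙 B) (by simp) (𝟙 X) (𝟙 Y) (by simp) = 𝟙 _ := by
  apply hom_ext <;> simp
end Map

section Closed
variable [SymmetricCategory C] [MonoidalClosed C]
variable {f : A ⟶ B} {g : X ⟶ Y} {h : S ⟶ T}

lemma hom_ext_right {a b : dom f g ⊗ U ⟶ V}
    (h₁ : inl f g ▷ U ≫ a = inl f g ▷ U ≫ b) (h₂ : inr f g ▷ U ≫ a = inr f g ▷ U ≫ b) :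
    a = b := ((isPushout f g).map (tensorRight U)).hom_ext h₁ h₂

lemma hom_ext_left {a b : U ⊗ dom f g ⟶ V}
    (h₁ : U ◁ inl f g ≫ a = U ◁ inl f g ≫ b) (h₂ : U ◁ inr f g ≫ a = U ◁ inr f g ≫ b) :
    a = b := ((isPushout f g).map (tensorLeft U)).hom_ext h₁ h₂

lemma hom_ext_right_right {a b : (dom f g ⊗ U) ⊗ S ⟶ V}
    (h₁ : inl f g ▷ U ▷ S ≫ a = inl f g ▷ U ▷ S ≫ b)
    (h₂ : inr f g ▷ U ▷ S ≫ a = inr f g ▷ U ▷ S ≫ b) :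
    a = b := ((isPushout f g).map (tensorRight U ⋙ tensorRight S)).hom_ext h₁ h₂

def descRight (a : (B ⊗ X) ⊗ U ⟶ V) (b : (A ⊗ Y) ⊗ U ⟶ V)
    (w : f ▷ X ▷ U ≫ a = (A ◁ g) ▷ U ≫ b) : dom f g ⊗ U ⟶ V :=
  ((isPushout f g).map (tensorRight U)).desc a b w
def descLeft (a : U ⊗ (B ⊗ X) ⟶ V) (b : U ⊗ (A ⊗ Y) ⟶ V)
    (w : U ◁ f ▷ X ≫ a = U ◁ A ◁ g ≫ b) : U ⊗ dom f g ⟶ V :=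
  ((isPushout f g).map (tensorLeft U)).desc a b w

section
variable (a : (B ⊗ X) ⊗ U ⟶ V) (b : (A ⊗ Y) ⊗ U ⟶ V) (w : f ▷ X ▷ U ≫ a = (A ◁ g) ▷ U ≫ b)
@[simp] lemma inl_descRight : inl f g ▷ U ≫ descRight a b w = a :=
  ((isPushout f g).map (tensorRight U)).inl_desc a b w
@[simp] lemma inl_descRight_assoc (k : V ⟶ S) : inl f g ▷ U ≫ descRight a b w ≫ k = a ≫ k := by
  rw [← Category.assoc, inl_descRight]
@[simp] lemma inr_descRight : inr f g ▷ U ≫ descRight a b w = b :=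
  ((isPushout f g).map (tensorRight U)).inr_desc a b w
@[simp] lemma inr_descRight_assoc (k : V ⟶ S) : inr f g ▷ U ≫ descRight a b w ≫ k = b ≫ k := by
  rw [← Category.assoc, inr_descRight]
end

section
variable (a : U ⊗ (B ⊗ X) ⟶ V) (b : U ⊗ (A ⊗ Y) ⟶ V) (w : U ◁ f ▷ X ≫ a = U ◁ A ◁ g ≫ b)
@[simp] lemma inl_descLeft : U ◁ inl f g ≫ descLeft a b w = a :=
  ((isPushout f g).map (tensorLeft U)).inl_desc a b w
@[simp] lemma inl_descLeft_assoc (k : V ⟶ S) : U ◁ inl f g ≫ descLeft a b w ≫ k = a ≫ k := by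
  rw [← Category.assoc, inl_descLeft]
@[simp] lemma inr_descLeft : U ◁ inr f g ≫ descLeft a b w = b :=
  ((isPushout f g).map (tensorLeft U)).inr_desc a b w
@[simp] lemma inr_descLeft_assoc (k : V ⟶ S) : U ◁ inr f g ≫ descLeft a b w ≫ k = b ≫ k := by
  rw [← Category.assoc, inr_descLeft]
end


@[simp] lemma inl_ι_right : inl f g ▷ U ≫ ι f g ▷ U = (B ◁ g) ▷ U := by
  rw [← comp_whiskerRight, inl_ι]
@[simp] lemma inr_ι_right : inr f g ▷ U ≫ ι f g ▷ U = f ▷ Y ▷ U := by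
  rw [← comp_whiskerRight, inr_ι]
@[simp] lemma inl_ι_left : U ◁ inl f g ≫ U ◁ ι f g = U ◁ B ◁ g := by
  rw [← MonoidalCategory.whiskerLeft_comp, inl_ι]
@[simp] lemma inr_ι_left : U ◁ inr f g ≫ U ◁ ι f g = U ◁ f ▷ Y := by
  rw [← MonoidalCategory.whiskerLeft_comp, inr_ι]
@[simp] lemma inl_ι_right_assoc (k : (B ⊗ Y) ⊗ U ⟶ V) :
    inl f g ▷ U ≫ ι f g ▷ U ≫ k = (B ◁ g) ▷ U ≫ k := by rw [← Category.assoc, inl_ι_right]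
@[simp] lemma inr_ι_right_assoc (k : (B ⊗ Y) ⊗ U ⟶ V) :
    inr f g ▷ U ≫ ι f g ▷ U ≫ k = f ▷ Y ▷ U ≫ k := by rw [← Category.assoc, inr_ι_right]
@[simp] lemma inl_ι_left_assoc (k : U ⊗ (B ⊗ Y) ⟶ V) :
    U ◁ inl f g ≫ U ◁ ι f g ≫ k = U ◁ B ◁ g ≫ k := by rw [← Category.assoc, inl_ι_left]
@[simp] lemma inr_ι_left_assoc (k : U ⊗ (B ⊗ Y) ⟶ V) :
    U ◁ inr f g ≫ U ◁ ι f g ≫ k = U ◁ f ▷ Y ≫ k := by rw [← Category.assoc, inr_ι_left]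

lemma cond_left : U ◁ f ▷ X ≫ U ◁ inl f g = U ◁ A ◁ g ≫ U ◁ inr f g := by
  rw [← MonoidalCategory.whiskerLeft_comp, cond, MonoidalCategory.whiskerLeft_comp]
lemma cond_right : f ▷ X ▷ U ≫ inl f g ▷ U = (A ◁ g) ▷ U ≫ inr f g ▷ U := by
  rw [← comp_whiskerRight, cond, comp_whiskerRight]

variable (f g h)
lemma assoc_cond : f ▷ X ▷ T ≫ (α_ B X T).hom ≫ B ◁ inr g h ≫ inl f (ι g h) =
    (A ◁ g) ▷ T ≫ (α_ A Y T).hom ≫ inr f (ι g h) := by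
  have := cond f (ι g h)
  have := congrArg (fun k => (α_ A X T).hom ≫ A ◁ inr g h ≫ k) this
  simpa [whisker_exchange_assoc] using this

def assocHom : dom (ι f g) h ⟶ dom f (ι g h) :=
  desc ((α_ B Y S).hom ≫ B ◁ inl g h ≫ inl f (ι g h))
    (descRight ((α_ B X T).hom ≫ B ◁ inr g h ≫ inl f (ι g h))
      ((α_ A Y T).hom ≫ inr f (ι g h)) (assoc_cond f g h))
    (by
      apply hom_ext_right
      · have := cond_left (U := B) (f := g) (g := h)
        have := congrArg (fun k => (α_ B X S).hom ≫ k ≫ inl f (ι g h)) this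
        simpa [← whisker_exchange_assoc] using this
      · have := cond f (ι g h)
        have := congrArg (fun k => (α_ A Y S).hom ≫ A ◁ inl g h ≫ k) this
        simp [whisker_exchange_assoc] at this
        simp [← whisker_exchange_assoc]
        simpa using this)

def assocInv : dom f (ι g h) ⟶ dom (ι f g) h :=
  desc (descLeft ((α_ B Y S).inv ≫ inl (ι f g) h)
      ((α_ B X T).inv ≫ inl f g ▷ T ≫ inr (ι f g) h)
      (by
        have := cond (ι f g) h
        have := congrArg (fun k => (α_ B X S).inv ≫ inl f g ▷ S ≫ k) this
        simpa [← whisker_exchange_assoc] using this))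
    ((α_ A Y T).inv ≫ inr f g ▷ T ≫ inr (ι f g) h)
    (by
      apply hom_ext_left
      · have := cond (ι f g) h
        have := congrArg (fun k => (α_ A Y S).inv ≫ inr f g ▷ S ≫ k) this
        simp [← whisker_exchange_assoc] at this
        simp [whisker_exchange_assoc]
        simpa using this
      · have := cond_right (U := T) (f := f) (g := g)
        have := congrArg (fun k => (α_ A X T).inv ≫ k ≫ inr (ι f g) h) this
        simpa [whisker_exchange_assoc] using this)

@[simp] lemma inl_assocHom : inl (ι f g) h ≫ assocHom f g h =
    (α_ B Y S).hom ≫ B ◁ inl g h ≫ inl f (ι g h) := inl_desc _ _ _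
@[simp] lemma inr_assocHom : inr (ι f g) h ≫ assocHom f g h =
    descRight ((α_ B X T).hom ≫ B ◁ inr g h ≫ inl f (ι g h))
      ((α_ A Y T).hom ≫ inr f (ι g h)) (assoc_cond f g h) := inr_desc _ _ _
@[simp] lemma inl_assocHom_assoc (k : dom f (ι g h) ⟶ V) : inl (ι f g) h ≫ assocHom f g h ≫ k =
    (α_ B Y S).hom ≫ B ◁ inl g h ≫ inl f (ι g h) ≫ k := by
  rw [← Category.assoc, inl_assocHom]; simp
lemma inlr_assocHom_assoc (k : dom f (ι g h) ⟶ V) :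
    inl f g ▷ T ≫ inr (ι f g) h ≫ assocHom f g h ≫ k =
    (α_ B X T).hom ≫ B ◁ inr g h ≫ inl f (ι g h) ≫ k := by
  rw [← Category.assoc (inr _ _), inr_assocHom, inl_descRight_assoc]; simp
lemma inrr_assocHom_assoc (k : dom f (ι g h) ⟶ V) :
    inr f g ▷ T ≫ inr (ι f g) h ≫ assocHom f g h ≫ k =
    (α_ A Y T).hom ≫ inr f (ι g h) ≫ k := by
  rw [← Category.assoc (inr _ _), inr_assocHom, inr_descRight_assoc]; simp

lemma inlr_assocHom : inl f g ▷ T ≫ inr (ι f g) h ≫ assocHom f g h =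
    (α_ B X T).hom ≫ B ◁ inr g h ≫ inl f (ι g h) := by
  rw [inr_assocHom, inl_descRight]
lemma inrr_assocHom : inr f g ▷ T ≫ inr (ι f g) h ≫ assocHom f g h =
    (α_ A Y T).hom ≫ inr f (ι g h) := by
  rw [inr_assocHom, inr_descRight]

lemma assoc_hom_ext {a b : dom (ι f g) h ⟶ V} (h₁ : inl (ι f g) h ≫ a = inl (ι f g) h ≫ b)
    (h₂ : inl f g ▷ T ≫ inr (ι f g) h ≫ a = inl f g ▷ T ≫ inr (ι f g) h ≫ b)
    (h₃ : inr f g ▷ T ≫ inr (ι f g) h ≫ a = inr f g ▷ T ≫ inr (ι f g) h ≫ b) : a = b :=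
  hom_ext h₁ (hom_ext_right h₂ h₃)

lemma assocInv_hom_ext {a b : dom f (ι g h) ⟶ V} (h₁ : inr f (ι g h) ≫ a = inr f (ι g h) ≫ b)
    (h₂ : B ◁ inl g h ≫ inl f (ι g h) ≫ a = B ◁ inl g h ≫ inl f (ι g h) ≫ b)
    (h₃ : B ◁ inr g h ≫ inl f (ι g h) ≫ a = B ◁ inr g h ≫ inl f (ι g h) ≫ b) : a = b :=
  hom_ext (hom_ext_left h₂ h₃) h₁

lemma inr_assocInv_assoc (k : dom (ι f g) h ⟶ V) : inr f (ι g h) ≫ assocInv f g h ≫ k =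
    (α_ A Y T).inv ≫ inr f g ▷ T ≫ inr (ι f g) h ≫ k := by
  simp [assocInv]
lemma inll_assocInv_assoc (k : dom (ι f g) h ⟶ V) :
    B ◁ inl g h ≫ inl f (ι g h) ≫ assocInv f g h ≫ k =
    (α_ B Y S).inv ≫ inl (ι f g) h ≫ k := by
  simp [assocInv]
lemma inrl_assocInv_assoc (k : dom (ι f g) h ⟶ V) :
    B ◁ inr g h ≫ inl f (ι g h) ≫ assocInv f g h ≫ k =
    (α_ B X T).inv ≫ inl f g ▷ T ≫ inr (ι f g) h ≫ k := by
  simp [assocInv]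
attribute [local simp] inr_assocInv_assoc inll_assocInv_assoc inrl_assocInv_assoc
  inlr_assocHom_assoc inrr_assocHom_assoc

lemma assocHom_assocInv : assocHom f g h ≫ assocInv f g h = 𝟙 _ := by
  apply assoc_hom_ext
  · have := inll_assocInv_assoc f g h (𝟙 _)
    simp at this
    simp [this]
  · have := inrl_assocInv_assoc f g h (𝟙 _)
    simp at this
    simp [this]
  · have := inr_assocInv_assoc f g h (𝟙 _)
    simp at this
    simp [this]

lemma assocInv_assocHom : assocInv f g h ≫ assocHom f g h = 𝟙 _ := by
  apply assocInv_hom_ext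
  · simp
  · simp
  · simp

lemma assocInv_ι : assocInv f g h ≫ ι (ι f g) h = ι f (ι g h) ≫ (α_ B Y T).inv := by
  apply assocInv_hom_ext
  · simp [← comp_whiskerRight]
  · simp
  · simp [← comp_whiskerRight]

lemma assocHom_ι : assocHom f g h ≫ ι f (ι g h) = ι (ι f g) h ≫ (α_ B Y T).hom := by
  apply assoc_hom_ext
  · simp [← MonoidalCategory.whiskerLeft_comp]
  · simp
  · simp [← comp_whiskerRight_assoc]

section
variable {A' B' X' Y' S' T' : C} {f : A ⟶ B} {f' : A' ⟶ B'} {g : X ⟶ Y} {g' : X' ⟶ Y'}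
  {h : S ⟶ T} {h' : S' ⟶ T'}
  (l : A ⟶ A') (r : B ⟶ B') (w : l ≫ f' = f ≫ r) (l' : X ⟶ X') (r' : Y ⟶ Y')
    (w' : l' ≫ g' = g ≫ r') (l'' : S ⟶ S') (r'' : T ⟶ T') (w'' : l'' ≫ h' = h ≫ r'')

lemma inl_map_tensor (k : U ⟶ V) : inl f g ▷ U ≫ (map l r w l' r' w' ⊗ₘ k) =
    ((r ⊗ₘ l') ⊗ₘ k) ≫ inl f' g' ▷ V := by
  simp only [← tensorHom_id, tensorHom_comp_tensorHom, inl_map, Category.id_comp, Category.comp_id]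
lemma inr_map_tensor (k : U ⟶ V) : inr f g ▷ U ≫ (map l r w l' r' w' ⊗ₘ k) =
    ((l ⊗ₘ r') ⊗ₘ k) ≫ inr f' g' ▷ V := by
  simp only [← tensorHom_id, tensorHom_comp_tensorHom, inr_map, Category.id_comp, Category.comp_id]
lemma tensor_map_inl (k : U ⟶ V) : U ◁ inl f g ≫ (k ⊗ₘ map l r w l' r' w') =
    (k ⊗ₘ (r ⊗ₘ l')) ≫ V ◁ inl f' g' := by
  simp only [← id_tensorHom, tensorHom_comp_tensorHom, inl_map, Category.id_comp, Category.comp_id]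
lemma tensor_map_inr (k : U ⟶ V) : U ◁ inr f g ≫ (k ⊗ₘ map l r w l' r' w') =
    (k ⊗ₘ (l ⊗ₘ r')) ≫ V ◁ inr f' g' := by
  simp only [← id_tensorHom, tensorHom_comp_tensorHom, inr_map, Category.id_comp, Category.comp_id]

lemma inl_map_tensor_assoc (k : U ⟶ V) (z : dom f' g' ⊗ V ⟶ S) :
    inl f g ▷ U ≫ (map l r w l' r' w' ⊗ₘ k) ≫ z = ((r ⊗ₘ l') ⊗ₘ k) ≫ inl f' g' ▷ V ≫ z := by
  rw [← Category.assoc, inl_map_tensor, Category.assoc]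
lemma inr_map_tensor_assoc (k : U ⟶ V) (z : dom f' g' ⊗ V ⟶ S) :
    inr f g ▷ U ≫ (map l r w l' r' w' ⊗ₘ k) ≫ z = ((l ⊗ₘ r') ⊗ₘ k) ≫ inr f' g' ▷ V ≫ z := by
  rw [← Category.assoc, inr_map_tensor, Category.assoc]
lemma tensor_map_inl_assoc (k : U ⟶ V) (z : V ⊗ dom f' g' ⟶ S) :
    U ◁ inl f g ≫ (k ⊗ₘ map l r w l' r' w') ≫ z = (k ⊗ₘ (r ⊗ₘ l')) ≫ V ◁ inl f' g' ≫ z := by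
  rw [← Category.assoc, tensor_map_inl, Category.assoc]
lemma tensor_map_inr_assoc (k : U ⟶ V) (z : V ⊗ dom f' g' ⟶ S) :
    U ◁ inr f g ≫ (k ⊗ₘ map l r w l' r' w') ≫ z = (k ⊗ₘ (l ⊗ₘ r')) ≫ V ◁ inr f' g' ≫ z := by
  rw [← Category.assoc, tensor_map_inr, Category.assoc]

lemma assocHom_naturality :
    map (map l r w l' r' w') (r ⊗ₘ r') (map_ι l r w l' r' w') l'' r'' w'' ≫ assocHom f' g' h' =
    assocHom f g h ≫ map l r w (map l' r' w' l'' r'' w'') (r' ⊗ₘ r'') (map_ι l' r' w' l'' r'' w'') := by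
  apply assoc_hom_ext
  · simp only [inl_map_assoc, inl_assocHom, inl_assocHom_assoc, inl_map, tensor_map_inl_assoc]
    simp
  · simp only [inr_map_assoc, inlr_assocHom_assoc, inlr_assocHom, inl_map, inl_map_tensor_assoc,
      tensor_map_inr_assoc]
    simp
  · simp only [inr_map_assoc, inrr_assocHom_assoc, inr_map, inr_map_tensor_assoc, inrr_assocHom]
    simp
end

lemma inl_assocHom_left : U ◁ inl (ι f g) h ≫ U ◁ assocHom f g h =
    U ◁ (α_ B Y S).hom ≫ U ◁ B ◁ inl g h ≫ U ◁ inl f (ι g h) := by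
  simp only [← MonoidalCategory.whiskerLeft_comp, inl_assocHom]
lemma inl_assocHom_left_assoc (k : U ⊗ dom f (ι g h) ⟶ V) : U ◁ inl (ι f g) h ≫ U ◁ assocHom f g h ≫ k =
    U ◁ (α_ B Y S).hom ≫ U ◁ B ◁ inl g h ≫ U ◁ inl f (ι g h) ≫ k := by
  simp only [← Category.assoc, ← MonoidalCategory.whiskerLeft_comp]
  simp only [Category.assoc, inl_assocHom]

lemma inl_assocHom_right : inl (ι f g) h ▷ U ≫ assocHom f g h ▷ U =
    (α_ B Y S).hom ▷ U ≫ (B ◁ inl g h) ▷ U ≫ inl f (ι g h) ▷ U := by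
  simp only [← comp_whiskerRight, inl_assocHom]
lemma inl_assocHom_right_assoc (k : dom f (ι g h) ⊗ U ⟶ V) : inl (ι f g) h ▷ U ≫ assocHom f g h ▷ U ≫ k =
    (α_ B Y S).hom ▷ U ≫ (B ◁ inl g h) ▷ U ≫ inl f (ι g h) ▷ U ≫ k := by
  simp only [← Category.assoc, ← comp_whiskerRight]
  simp only [Category.assoc, inl_assocHom]

lemma inlr_assocHom_left : U ◁ inl f g ▷ T ≫ U ◁ inr (ι f g) h ≫ U ◁ assocHom f g h =
    U ◁ (α_ B X T).hom ≫ U ◁ B ◁ inr g h ≫ U ◁ inl f (ι g h) := by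
  simp only [← MonoidalCategory.whiskerLeft_comp, inlr_assocHom]
lemma inlr_assocHom_left_assoc (k : U ⊗ dom f (ι g h) ⟶ V) : U ◁ inl f g ▷ T ≫ U ◁ inr (ι f g) h ≫ U ◁ assocHom f g h ≫ k =
    U ◁ (α_ B X T).hom ≫ U ◁ B ◁ inr g h ≫ U ◁ inl f (ι g h) ≫ k := by
  simp only [← Category.assoc, ← MonoidalCategory.whiskerLeft_comp]
  simp only [Category.assoc, inlr_assocHom]

lemma inlr_assocHom_right : inl f g ▷ T ▷ U ≫ inr (ι f g) h ▷ U ≫ assocHom f g h ▷ U =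
    (α_ B X T).hom ▷ U ≫ (B ◁ inr g h) ▷ U ≫ inl f (ι g h) ▷ U := by
  simp only [← comp_whiskerRight, inlr_assocHom]
lemma inlr_assocHom_right_assoc (k : dom f (ι g h) ⊗ U ⟶ V) : inl f g ▷ T ▷ U ≫ inr (ι f g) h ▷ U ≫ assocHom f g h ▷ U ≫ k =
    (α_ B X T).hom ▷ U ≫ (B ◁ inr g h) ▷ U ≫ inl f (ι g h) ▷ U ≫ k := by
  simp only [← Category.assoc, ← comp_whiskerRight]
  simp only [Category.assoc, inlr_assocHom]

lemma inrr_assocHom_left : U ◁ inr f g ▷ T ≫ U ◁ inr (ι f g) h ≫ U ◁ assocHom f g h =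
    U ◁ (α_ A Y T).hom ≫ U ◁ inr f (ι g h) := by
  simp only [← MonoidalCategory.whiskerLeft_comp, inrr_assocHom]
lemma inrr_assocHom_left_assoc (k : U ⊗ dom f (ι g h) ⟶ V) : U ◁ inr f g ▷ T ≫ U ◁ inr (ι f g) h ≫ U ◁ assocHom f g h ≫ k =
    U ◁ (α_ A Y T).hom ≫ U ◁ inr f (ι g h) ≫ k := by
  simp only [← Category.assoc, ← MonoidalCategory.whiskerLeft_comp]
  simp only [Category.assoc, inrr_assocHom]

lemma inrr_assocHom_right : inr f g ▷ T ▷ U ≫ inr (ι f g) h ▷ U ≫ assocHom f g h ▷ U =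
    (α_ A Y T).hom ▷ U ≫ inr f (ι g h) ▷ U := by
  simp only [← comp_whiskerRight, inrr_assocHom]
lemma inrr_assocHom_right_assoc (k : dom f (ι g h) ⊗ U ⟶ V) : inr f g ▷ T ▷ U ≫ inr (ι f g) h ▷ U ≫ assocHom f g h ▷ U ≫ k =
    (α_ A Y T).hom ▷ U ≫ inr f (ι g h) ▷ U ≫ k := by
  simp only [← Category.assoc, ← comp_whiskerRight]
  simp only [Category.assoc, inrr_assocHom]

section
variable {P Q : C} (p : P ⟶ Q)
lemma pentagon : map (assocHom f g h) (α_ B Y T).hom (assocHom_ι f g h) (𝟙 P) (𝟙 Q) (by simp) ≫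
      assocHom f (ι g h) p ≫
        map (𝟙 A) (𝟙 B) (by simp) (assocHom g h p) (α_ Y T Q).hom (assocHom_ι g h p) =
    assocHom (ι f g) h p ≫ assocHom f g (ι h p) := by
  apply hom_ext
  · simp [inl_assocHom_left_assoc]
  · apply hom_ext_right
    · simp [inl_assocHom_right_assoc, inlr_assocHom_left_assoc, inlr_assocHom_assoc]
    · apply hom_ext_right_right
      · simp [inlr_assocHom_right_assoc, inrr_assocHom_left_assoc, inlr_assocHom_assoc,
          inrr_assocHom_assoc]
        rw [associator_naturality_left_assoc, inl_descRight]
      · simp [inrr_assocHom_right_assoc, inrr_assocHom_assoc]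
        rw [associator_naturality_left_assoc, inr_descRight]
end

/-! braiding -/
variable {f g h}
def braid (f : A ⟶ B) (g : X ⟶ Y) : dom f g ⟶ dom g f :=
  desc ((β_ B X).hom ≫ inr g f) ((β_ A Y).hom ≫ inl g f) (by
    rw [BraidedCategory.braiding_naturality_left_assoc,
      BraidedCategory.braiding_naturality_right_assoc, cond])
@[simp] lemma inl_braid : inl f g ≫ braid f g = (β_ B X).hom ≫ inr g f := inl_desc _ _ _
@[simp] lemma inr_braid : inr f g ≫ braid f g = (β_ A Y).hom ≫ inl g f := inr_desc _ _ _
@[simp] lemma inl_braid_assoc (k : dom g f ⟶ V) :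
    inl f g ≫ braid f g ≫ k = (β_ B X).hom ≫ inr g f ≫ k := by
  rw [← Category.assoc, inl_braid, Category.assoc]
@[simp] lemma inr_braid_assoc (k : dom g f ⟶ V) :
    inr f g ≫ braid f g ≫ k = (β_ A Y).hom ≫ inl g f ≫ k := by
  rw [← Category.assoc, inr_braid, Category.assoc]
lemma braid_ι : braid f g ≫ ι g f = ι f g ≫ (β_ B Y).hom := by
  apply hom_ext <;> simp
lemma braid_braid : braid f g ≫ braid g f = 𝟙 _ := by
  apply hom_ext <;> simp
lemma braid_naturality {A' B' X' Y' : C} {f' : A' ⟶ B'} {g' : X' ⟶ Y'}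
    (l : A ⟶ A') (r : B ⟶ B') (w : l ≫ f' = f ≫ r) (l' : X ⟶ X') (r' : Y ⟶ Y')
    (w' : l' ≫ g' = g ≫ r') :
    map l r w l' r' w' ≫ braid f' g' = braid f g ≫ map l' r' w' l r w := by
  apply hom_ext <;> simp [BraidedCategory.braiding_naturality_assoc]

lemma inl_braid_left : U ◁ inl f g ≫ U ◁ braid f g = U ◁ (β_ B X).hom ≫ U ◁ inr g f := by
  simp only [← MonoidalCategory.whiskerLeft_comp, inl_braid]
lemma inr_braid_left : U ◁ inr f g ≫ U ◁ braid f g = U ◁ (β_ A Y).hom ≫ U ◁ inl g f := by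
  simp only [← MonoidalCategory.whiskerLeft_comp, inr_braid]
lemma inl_braid_right : inl f g ▷ U ≫ braid f g ▷ U = (β_ B X).hom ▷ U ≫ inr g f ▷ U := by
  simp only [← comp_whiskerRight, inl_braid]
lemma inr_braid_right : inr f g ▷ U ≫ braid f g ▷ U = (β_ A Y).hom ▷ U ≫ inl g f ▷ U := by
  simp only [← comp_whiskerRight, inr_braid]

lemma hexagon : assocHom f g h ≫ braid f (ι g h) ≫ assocHom g h f =
    map (braid f g) (β_ B Y).hom braid_ι (𝟙 S) (𝟙 T) (by simp) ≫ assocHom g f h ≫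
      map (𝟙 X) (𝟙 Y) (by simp) (braid f h) (β_ B T).hom braid_ι := by
  apply assoc_hom_ext
  · simp [reassoc_of% (inl_braid_left (U := Y) (f := f) (g := h))]
  · simp [reassoc_of% (inl_braid_right (U := T) (f := f) (g := g)), inrr_assocHom_assoc]
  · simp [reassoc_of% (inr_braid_right (U := T) (f := f) (g := g)), inlr_assocHom_assoc,
      reassoc_of% (inr_braid_left (U := Y) (f := f) (g := h))]

/-! unitors -/
variable [HasInitial C]
def isInitialTensor (X : C) : IsInitial (X ⊗ ⊥_ C) :=
  IsInitial.isInitialObj (tensorLeft X) _ initialIsInitial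
def tensorIsInitial (X : C) : IsInitial ((⊥_ C) ⊗ X) :=
  IsInitial.isInitialObj (tensorRight X) _ initialIsInitial
variable (f)
def rightUnit : dom f (initial.to (𝟙_ C)) ⟶ A :=
  desc ((isInitialTensor B).to A) (ρ_ A).hom ((isInitialTensor A).hom_ext _ _)
@[simp] lemma inr_rightUnit : inr f (initial.to (𝟙_ C)) ≫ rightUnit f = (ρ_ A).hom :=
  inr_desc _ _ _
@[simp] lemma inr_rightUnit_assoc (k : A ⟶ V) :
    inr f (initial.to (𝟙_ C)) ≫ rightUnit f ≫ k = (ρ_ A).hom ≫ k := by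
  rw [← Category.assoc, inr_rightUnit]
def rightUnitInv : A ⟶ dom f (initial.to (𝟙_ C)) := (ρ_ A).inv ≫ inr f (initial.to (𝟙_ C))
lemma rightUnit_inv : rightUnit f ≫ rightUnitInv f = 𝟙 _ :=
  hom_ext ((isInitialTensor B).hom_ext _ _) (by simp [rightUnitInv])
lemma rightUnit_ι : rightUnit f ≫ f = ι f (initial.to (𝟙_ C)) ≫ (ρ_ B).hom :=
  hom_ext ((isInitialTensor B).hom_ext _ _) (by simp)
lemma rightUnit_naturality {A' B' : C} {f' : A' ⟶ B'}
    (l : A ⟶ A') (r : B ⟶ B') (w : l ≫ f' = f ≫ r) :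
    map l r w (𝟙 _) (𝟙 _) (by simp) ≫ rightUnit f' = rightUnit f ≫ l :=
  hom_ext ((isInitialTensor B).hom_ext _ _) (by simp)
def leftUnit : dom (initial.to (𝟙_ C)) f ⟶ A :=
  desc (λ_ A).hom ((tensorIsInitial B).to A) ((tensorIsInitial A).hom_ext _ _)
@[simp] lemma inl_leftUnit : inl (initial.to (𝟙_ C)) f ≫ leftUnit f = (λ_ A).hom :=
  inl_desc _ _ _
@[simp] lemma inl_leftUnit_assoc (k : A ⟶ V) :
    inl (initial.to (𝟙_ C)) f ≫ leftUnit f ≫ k = (λ_ A).hom ≫ k := by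
  rw [← Category.assoc, inl_leftUnit]
def leftUnitInv : A ⟶ dom (initial.to (𝟙_ C)) f := (λ_ A).inv ≫ inl (initial.to (𝟙_ C)) f
lemma leftUnit_inv : leftUnit f ≫ leftUnitInv f = 𝟙 _ :=
  hom_ext (by simp [leftUnitInv]) ((tensorIsInitial B).hom_ext _ _)
lemma leftUnit_ι : leftUnit f ≫ f = ι (initial.to (𝟙_ C)) f ≫ (λ_ B).hom :=
  hom_ext (by simp) ((tensorIsInitial B).hom_ext _ _)
lemma leftUnit_naturality {A' B' : C} {f' : A' ⟶ B'}
    (l : A ⟶ A') (r : B ⟶ B') (w : l ≫ f' = f ≫ r) :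
    map (𝟙 _) (𝟙 _) (by simp) l r w ≫ leftUnit f' = leftUnit f ≫ l :=
  hom_ext (by simp) ((tensorIsInitial B).hom_ext _ _)
lemma triangle : assocHom f (initial.to (𝟙_ C)) g ≫
    map (𝟙 A) (𝟙 B) (by simp) (leftUnit g) (λ_ Y).hom (leftUnit_ι g) =
    map (rightUnit f) (ρ_ B).hom (rightUnit_ι f) (𝟙 _) (𝟙 _) (by simp) := by
  apply assoc_hom_ext
  · simp [← MonoidalCategory.whiskerLeft_comp_assoc]
  · have i : IsInitial ((B ⊗ ⊥_ C) ⊗ Y) := IsInitial.isInitialObj (tensorRight Y) _ (isInitialTensor B)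
    exact i.hom_ext _ _
  · simp [← comp_whiskerRight_assoc]

section Instances
/-- The pushout-product monoidal structure on the arrow category of a closed symmetric monoidal
category; its unit is `⊥ ⟶ 𝟙_ C`. -/
scoped instance monoidalCategoryStruct : MonoidalCategoryStruct (Arrow C) where
  tensorObj f g := Arrow.mk (ι f.hom g.hom)
  whiskerLeft f _ _ k := Arrow.homMk' (map (𝟙 _) (𝟙 _) (by simp) k.left k.right k.w)
    (_ ◁ k.right) (by rw [← id_tensorHom]; exact map_ι _ _ _ _ _ _)
  whiskerRight k g := Arrow.homMk' (map k.left k.right k.w (𝟙 _) (𝟙 _) (by simp))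
    (k.right ▷ _) (by rw [← tensorHom_id]; exact map_ι _ _ _ _ _ _)
  tensorHom k k' := Arrow.homMk' (map k.left k.right k.w k'.left k'.right k'.w)
    (k.right ⊗ₘ k'.right) (map_ι _ _ _ _ _ _)
  tensorUnit := Arrow.mk (initial.to (𝟙_ C))
  associator f g h :=
    { hom := Arrow.homMk' (assocHom f.hom g.hom h.hom) (α_ _ _ _).hom (assocHom_ι _ _ _)
      inv := Arrow.homMk' (assocInv f.hom g.hom h.hom) (α_ _ _ _).inv (assocInv_ι _ _ _)
      hom_inv_id := Arrow.hom_ext _ _ (assocHom_assocInv _ _ _) (by simp)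
      inv_hom_id := Arrow.hom_ext _ _ (assocInv_assocHom _ _ _) (by simp) }
  leftUnitor f :=
    { hom := Arrow.homMk (leftUnit f.hom) (λ_ _).hom (leftUnit_ι _)
      inv := Arrow.homMk (leftUnitInv f.hom) (λ_ _).inv (by
        rw [leftUnitInv, Category.assoc]; exact (congrArg _ (inl_ι _ _)).trans (by simp))
      hom_inv_id := Arrow.hom_ext _ _ (leftUnit_inv _) (by simp)
      inv_hom_id := Arrow.hom_ext _ _ (by simp [leftUnitInv]) (by simp) }
  rightUnitor f :=
    { hom := Arrow.homMk (rightUnit f.hom) (ρ_ _).hom (rightUnit_ι _)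
      inv := Arrow.homMk (rightUnitInv f.hom) (ρ_ _).inv (by
        rw [rightUnitInv, Category.assoc]; exact (congrArg _ (inr_ι _ _)).trans (by simp))
      hom_inv_id := Arrow.hom_ext _ _ (rightUnit_inv _) (by simp)
      inv_hom_id := Arrow.hom_ext _ _ (by simp [rightUnitInv]) (by simp) }

scoped instance monoidalCategory : MonoidalCategory (Arrow C) where
  tensorHom_def k k' := Arrow.hom_ext _ _ (by
    refine Eq.trans ?_ (map_comp _ _ k.w _ _ (by simp) _ _ (by simp) _ _ k'.w).symm
    exact hom_ext ((inl_map _ _ k.w _ _ k'.w).trans (by simp))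
      ((inr_map _ _ k.w _ _ k'.w).trans (by simp))) (MonoidalCategory.tensorHom_def _ _)
  id_tensorHom_id f g := Arrow.hom_ext _ _ map_id (MonoidalCategory.id_tensorHom_id _ _)
  tensorHom_comp_tensorHom a b c d := Arrow.hom_ext _ _ (map_comp _ _ a.w _ _ b.w _ _ c.w _ _ d.w) (tensorHom_comp_tensorHom _ _ _ _)
  whiskerLeft_id f g := Arrow.hom_ext _ _ map_id (MonoidalCategory.whiskerLeft_id _ _)
  id_whiskerRight f g := Arrow.hom_ext _ _ map_id (MonoidalCategory.id_whiskerRight _ _)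
  associator_naturality a b c := Arrow.hom_ext _ _ (assocHom_naturality _ _ a.w _ _ b.w _ _ c.w) (associator_naturality _ _ _)
  leftUnitor_naturality a := Arrow.hom_ext _ _ (leftUnit_naturality _ _ _ a.w) (leftUnitor_naturality _)
  rightUnitor_naturality a := Arrow.hom_ext _ _ (rightUnit_naturality _ _ _ a.w) (rightUnitor_naturality _)
  pentagon f g h k := Arrow.hom_ext _ _ (pentagon _ _ _ _) (MonoidalCategory.pentagon _ _ _ _)
  triangle f g := Arrow.hom_ext _ _ (triangle _) (MonoidalCategory.triangle _ _)
def braidIso (f g : Arrow C) : f ⊗ g ≅ g ⊗ f where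
  hom := Arrow.homMk' (braid f.hom g.hom) (β_ _ _).hom braid_ι
  inv := Arrow.homMk' (braid g.hom f.hom) (β_ _ _).hom braid_ι
  hom_inv_id := Arrow.hom_ext _ _ braid_braid (SymmetricCategory.symmetry f.right g.right)
  inv_hom_id := Arrow.hom_ext _ _ braid_braid (SymmetricCategory.symmetry g.right f.right)

lemma hexagon_arrow (f g h : Arrow C) :
    (α_ f g h).hom ≫ (braidIso f (g ⊗ h)).hom ≫ (α_ g h f).hom =
      (braidIso f g).hom ▷ h ≫ (α_ g f h).hom ≫ g ◁ (braidIso f h).hom :=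
  Arrow.hom_ext _ _ hexagon (BraidedCategory.hexagon_forward f.right g.right h.right)

scoped instance braidedCategory : BraidedCategory (Arrow C) where
  braiding f g := braidIso f g
  braiding_naturality_right f _ _ k := Arrow.hom_ext _ _ (braid_naturality _ _ (by simp) _ _ k.w)
    (BraidedCategory.braiding_naturality_right f.right k.right)
  braiding_naturality_left k f := Arrow.hom_ext _ _ (braid_naturality _ _ k.w _ _ (by simp))
    (BraidedCategory.braiding_naturality_left k.right f.right)
  hexagon_forward := hexagon_arrow
  hexagon_reverse f g h := by
    have e : α_ h f g ≪≫ braidIso h (f ⊗ g) ≪≫ α_ f g h =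
        whiskerRightIso (braidIso h f) g ≪≫ α_ f h g ≪≫ whiskerLeftIso f (braidIso h g) :=
      Iso.ext (hexagon_arrow h f g)
    have := congrArg Iso.inv e
    simp only [Iso.trans_inv, Category.assoc] at this
    exact this

scoped instance symmetricCategory : SymmetricCategory (Arrow C) where
  symmetry f g := by
    exact Arrow.hom_ext ((braidIso f g).hom ≫ (braidIso g f).hom) _ braid_braid
      (SymmetricCategory.symmetry f.right g.right)
end Instances
end Closed
end
end PushoutProduct

namespace UnorderedTensor
noncomputable section
variable {C : Type u} [Category.{v} C] [MonoidalCategory C]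
variable {α β γ : Type w}

/-- `X a₁ ⊗ (X a₂ ⊗ (⋯ ⊗ (X aₙ ⊗ 𝟙)))` for a list `[a₁, …, aₙ]`. -/
def tensorList (X : α → C) : List α → C
  | [] => 𝟙_ C
  | a :: l => X a ⊗ tensorList X l

/-- `Insertion a l l'`: the list `l'` is obtained from `l` by inserting `a` at some place. -/
inductive Insertion (a : α) : List α → List α → Type w
  | here (l : List α) : Insertion a l (a :: l)
  | there (b : α) {l l' : List α} (i : Insertion a l l') : Insertion a (b :: l) (b :: l')

/-- `Rearrangement l m`: a way of rearranging `l` into `m`, by successive insertion. -/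
inductive Rearrangement : List α → List α → Type w
  | nil : Rearrangement [] []
  | cons (a : α) {l m m' : List α} (p : Rearrangement l m) (i : Insertion a m m') :
      Rearrangement (a :: l) m'

section
variable [SymmetricCategory C]

/-- The symmetry `A ⊗ (B ⊗ M) ≅ B ⊗ (A ⊗ M)`. -/
def swap (A B M : C) : A ⊗ (B ⊗ M) ≅ B ⊗ (A ⊗ M) :=
  (α_ A B M).symm ≪≫ whiskerRightIso (β_ A B) M ≪≫ α_ B A M

lemma swap_hom (A B M : C) : (swap A B M).hom = (α_ A B M).inv ≫ (β_ A B).hom ▷ M ≫ (α_ B A M).hom := rfl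

lemma swap_swap (A B M : C) : (swap A B M).hom ≫ (swap B A M).hom = 𝟙 _ := by
  simp [swap_hom, ← comp_whiskerRight_assoc]

lemma swap_naturality {A A' B B' M M' : C} (f : A ⟶ A') (g : B ⟶ B') (h : M ⟶ M') :
    (f ⊗ₘ (g ⊗ₘ h)) ≫ (swap A' B' M').hom = (swap A B M).hom ≫ (g ⊗ₘ (f ⊗ₘ h)) := by
  simp only [swap_hom, Category.assoc]
  rw [associator_inv_naturality_assoc, ← associator_naturality, ← tensorHom_id, ← tensorHom_id,
    tensorHom_comp_tensorHom_assoc, tensorHom_comp_tensorHom_assoc, BraidedCategory.braiding_naturality]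
  simp

lemma swap_braid (A B D M : C) :
    A ◁ (swap B D M).hom ≫ (swap A D (B ⊗ M)).hom ≫ D ◁ (swap A B M).hom =
    (swap A B (D ⊗ M)).hom ≫ B ◁ (swap A D M).hom ≫ (swap B D (A ⊗ M)).hom := by
  have h := congrArg (fun k => 𝟙 (A ⊗ (B ⊗ (D ⊗ M))) ⊗≫ k ▷ M ⊗≫ 𝟙 (D ⊗ (B ⊗ (A ⊗ M)))) (BraidedCategory.yang_baxter A B D)
  calc _ = 𝟙 (A ⊗ (B ⊗ (D ⊗ M))) ⊗≫ (A ◁ (β_ B D).hom ≫ (α_ A D B).inv ≫ (β_ A D).hom ▷ B ≫ (α_ D A B).hom ≫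
        D ◁ (β_ A B).hom) ▷ M ⊗≫ 𝟙 (D ⊗ (B ⊗ (A ⊗ M))) := by
        simp only [swap_hom]; monoidal
    _ = _ := h.symm
    _ = _ := by simp only [swap_hom]; monoidal

variable (X : α → C)
/-- Moving the inserted factor to the front. -/
def Insertion.iso {a : α} : {l l' : List α} → Insertion a l l' → (tensorList X l' ≅ X a ⊗ tensorList X l)
  | _, _, .here l => Iso.refl _
  | _, _, .there (l := l) b i => whiskerLeftIso (X b) i.iso ≪≫ swap (X b) (X a) (tensorList X l)

def Rearrangement.iso : {l m : List α} → Rearrangement l m → (tensorList X l ≅ tensorList X m)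
  | _, _, .nil => Iso.refl _
  | _, _, .cons a p i => whiskerLeftIso (X a) p.iso ≪≫ (i.iso X).symm

lemma Insertion.iso_here (a : α) (l : List α) : (Insertion.here (a := a) l).iso X = Iso.refl _ := rfl
lemma Insertion.iso_there_hom {a b : α} {l l' : List α} (i : Insertion a l l') :
    ((Insertion.there b i).iso X).hom = X b ◁ (i.iso X).hom ≫ (swap (X b) (X a) (tensorList X l)).hom := rfl
lemma swap_naturality_right {A B M M' : C} (h : M ⟶ M') :
    A ◁ B ◁ h ≫ (swap A B M').hom = (swap A B M).hom ≫ B ◁ A ◁ h := by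
  simpa using swap_naturality (𝟙 A) (𝟙 B) h


section
variable {A B D L M N K P Q : C}
lemma exchange_there {J : N ⟶ B ⊗ M} {I : M ⟶ A ⊗ L} {I' : N ⟶ A ⊗ K} {J' : K ⟶ B ⊗ L}
    (h : J ≫ B ◁ I = I' ≫ A ◁ J' ≫ (swap A B L).hom) :
    (D ◁ J ≫ (swap D B M).hom) ≫ B ◁ (D ◁ I ≫ (swap D A L).hom) =
      (D ◁ I' ≫ (swap D A K).hom) ≫ A ◁ (D ◁ J' ≫ (swap D B L).hom) ≫
        (swap A B (D ⊗ L)).hom := by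
  have := congrArg (fun t => D ◁ t) h
  simp only [MonoidalCategory.whiskerLeft_comp, Category.assoc] at this ⊢
  rw [← reassoc_of% (swap_naturality_right (A := D) (B := B)), reassoc_of% this,
    swap_braid, ← reassoc_of% (swap_naturality_right (A := D) (B := A))]

lemma exchange_here₁ {I : M ⟶ A ⊗ L} : 𝟙 (B ⊗ M) ≫ B ◁ I =
    (B ◁ I ≫ (swap B A L).hom) ≫ A ◁ 𝟙 (B ⊗ L) ≫ (swap A B L).hom := by
  simp [swap_swap]

lemma exchange_here₂ {J : M ⟶ B ⊗ L} : (A ◁ J ≫ (swap A B L).hom) ≫ B ◁ 𝟙 (A ⊗ L) =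
    𝟙 (A ⊗ M) ≫ A ◁ J ≫ (swap A B L).hom := by
  simp

lemma extract_here {p : L ⟶ M} (j : N ≅ A ⊗ M) : (A ◁ p ≫ j.inv) ≫ j.hom = 𝟙 _ ≫ A ◁ p := by
  simp

lemma extract_there {p : L ⟶ M} {I : L ⟶ A ⊗ K} {j' : M ⟶ A ⊗ P} {p' : K ⟶ P}
    (h : p ≫ j' = I ≫ A ◁ p') {j : N ≅ B ⊗ M} {i2 : N ⟶ A ⊗ Q} (i1 : Q ≅ B ⊗ P)
    (h' : j.hom ≫ B ◁ j' = i2 ≫ A ◁ i1.hom ≫ (swap A B P).hom) :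
    (B ◁ p ≫ j.inv) ≫ i2 = (B ◁ I ≫ (swap B A K).hom) ≫ A ◁ (B ◁ p' ≫ i1.inv) := by
  have e : i2 = j.hom ≫ B ◁ j' ≫ (swap B A P).hom ≫ A ◁ i1.inv := by
    rw [reassoc_of% h', reassoc_of% (swap_swap A B P)]
    simp [← MonoidalCategory.whiskerLeft_comp]
  rw [e]
  have := congrArg (fun t => B ◁ t) h
  simp only [MonoidalCategory.whiskerLeft_comp, Category.assoc] at this ⊢
  rw [Iso.inv_hom_id_assoc, reassoc_of% this, reassoc_of% (swap_naturality_right (A := B) (B := A))]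
lemma comp_cons {r : L ⟶ Q} {p : L ⟶ M} {q' : M ⟶ Q} {j : N ≅ A ⊗ M} {q : N ⟶ P} {j' : P ≅ A ⊗ Q}
    (h : q ≫ j'.hom = j.hom ≫ A ◁ q') (hr : r = p ≫ q') :
    A ◁ r ≫ j'.inv = (A ◁ p ≫ j.inv) ≫ q := by
  rw [hr, Iso.comp_inv_eq, Category.assoc, Category.assoc, h]
  simp

lemma refl_cons {p : L ⟶ L} (h : p = 𝟙 L) : A ◁ p ≫ 𝟙 (A ⊗ L) = 𝟙 (A ⊗ L) := by simp [h]

lemma naturality_there {A' B' L' M' : C} {i : M ⟶ A ⊗ L} {j : M' ⟶ A' ⊗ L'} {m : M ⟶ M'}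
    {l : L ⟶ L'} {a : A ⟶ A'} {b : B ⟶ B'} (h : m ≫ j = i ≫ (a ⊗ₘ l)) :
    (b ⊗ₘ m) ≫ B' ◁ j ≫ (swap B' A' L').hom =
      (B ◁ i ≫ (swap B A L).hom) ≫ (a ⊗ₘ (b ⊗ₘ l)) := by
  rw [Category.assoc, ← swap_naturality, ← id_tensorHom, ← id_tensorHom,
    tensorHom_comp_tensorHom_assoc, tensorHom_comp_tensorHom_assoc, h]
  simp

lemma naturality_cons {A' L' M' N' : C} {l : L ⟶ L'} {m : M ⟶ M'} {n : N ⟶ N'} {a : A ⟶ A'} {q : L' ⟶ M'}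
    {p : L ⟶ M} (hq : l ≫ q = p ≫ m) {j : N' ≅ A' ⊗ M'} {i : N ≅ A ⊗ M}
    (hj : n ≫ j.hom = i.hom ≫ (a ⊗ₘ m)) :
    (a ⊗ₘ l) ≫ A' ◁ q ≫ j.inv = (A ◁ p ≫ i.inv) ≫ n := by
  rw [← Category.assoc, Iso.comp_inv_eq, Category.assoc, Category.assoc, hj, Iso.inv_hom_id_assoc,
    ← id_tensorHom, ← id_tensorHom, tensorHom_comp_tensorHom, tensorHom_comp_tensorHom, hq]
  simp

lemma id_cons_map {l : L ⟶ K} {e : L = K} (h : l = eqToHom e) (e' : A ⊗ L = A ⊗ K) :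
    (𝟙 A ⊗ₘ l) = eqToHom e' := by
  subst e h; simp

lemma comp_cons_map {A' A'' L' L'' K : C} {a : A ⟶ A'} {b : A' ⟶ A''} {l : L ⟶ L'} {m : L' ⟶ L''}
    {k : L ⟶ K} {e : K = L''} (h : l ≫ m = k ≫ eqToHom e) (e' : A'' ⊗ K = A'' ⊗ L'') :
    (a ⊗ₘ l) ≫ (b ⊗ₘ m) = ((a ≫ b) ⊗ₘ k) ≫ eqToHom e' := by
  subst e
  rw [tensorHom_comp_tensorHom, h]
  simp
end

lemma Insertion.exchange {a b : α} {l m n : List α} (i : Insertion a l m) (j : Insertion b m n) :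
    ∃ (k : List α) (j' : Insertion b l k) (i' : Insertion a k n),
      (j.iso X).hom ≫ X b ◁ (i.iso X).hom =
        (i'.iso X).hom ≫ X a ◁ (j'.iso X).hom ≫ (swap _ _ _).hom := by
  induction j generalizing l with
  | here m => exact ⟨_, .here _, .there _ i, exchange_here₁⟩
  | there c j ih =>
    cases i with
    | here l => exact ⟨_, j, .here _, exchange_here₂⟩
    | there _ i =>
      obtain ⟨k, j', i', h⟩ := ih i
      exact ⟨c :: k, .there c j', .there c i', exchange_there h⟩

lemma Rearrangement.extract {a : α} {l l' m : List α} (p : Rearrangement l m) (i : Insertion a l' l) :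
    ∃ (m' : List α) (p' : Rearrangement l' m') (j : Insertion a m' m),
      (p.iso X).hom ≫ (j.iso X).hom = (i.iso X).hom ≫ X a ◁ (p'.iso X).hom := by
  induction p generalizing l' with
  | nil => cases i
  | cons b p j ih =>
    cases i with
    | here l => exact ⟨_, p, j, extract_here _⟩
    | there _ i =>
      obtain ⟨m', p', j', h⟩ := ih i
      obtain ⟨k, i1, i2, h'⟩ := Insertion.exchange X j' j
      exact ⟨k, .cons b p' i1, i2, extract_there h _ h'⟩

lemma Rearrangement.comp {l m n : List α} (p : Rearrangement l m) (q : Rearrangement m n) :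
    ∃ r : Rearrangement l n, (r.iso X).hom = (p.iso X).hom ≫ (q.iso X).hom := by
  induction p generalizing n with
  | nil => exact ⟨q, (Category.id_comp _).symm⟩
  | cons a p j ih =>
    obtain ⟨n', q', j', h⟩ := q.extract X j
    obtain ⟨r, hr⟩ := ih q'
    exact ⟨.cons a r j', comp_cons h hr⟩
end

section
variable [SymmetricCategory C] {X : α → C}
lemma Insertion.perm {a : α} {l m : List α} (i : Insertion a l m) : m.Perm (a :: l) := by
  induction i with
  | here l => exact .refl _
  | there b _ ih => exact (ih.cons b).trans (.swap _ _ _)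

lemma Insertion.eq {a : α} {l l' m : List α} (hm : m.Nodup) (i : Insertion a l m)
    (j : Insertion a l' m) : ∃ h : l = l', h ▸ i = j := by
  induction i generalizing l' with
  | here l =>
    cases j with
    | here => exact ⟨rfl, rfl⟩
    | there _ j => exact absurd (j.perm.mem_iff.2 (by simp)) (List.nodup_cons.1 hm).1
  | there b i ih =>
    cases j with
    | here => exact absurd (i.perm.mem_iff.2 (by simp)) (List.nodup_cons.1 hm).1
    | there _ j =>
      obtain ⟨rfl, rfl⟩ := ih (List.nodup_cons.1 hm).2 j
      exact ⟨rfl, rfl⟩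

lemma Rearrangement.perm {l m : List α} (p : Rearrangement l m) : l.Perm m := by
  induction p with
  | nil => exact .refl _
  | cons a _ i ih => exact (ih.cons a).trans i.perm.symm

lemma Rearrangement.eq {l m : List α} (hm : m.Nodup) (p q : Rearrangement l m) : p = q := by
  induction p with
  | nil => cases q; rfl
  | cons a p i ih =>
    cases q with
    | cons _ q j =>
      obtain ⟨rfl, rfl⟩ := i.eq hm j
      rw [ih (List.nodup_cons.1 (i.perm.nodup_iff.1 hm)).2 q]

lemma Insertion.nonempty (a : α) : ∀ s t : List α, Nonempty (Insertion a (s ++ t) (s ++ a :: t))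
  | [], t => ⟨.here t⟩
  | b :: s, t => let ⟨i⟩ := Insertion.nonempty a s t; ⟨.there b i⟩

lemma Rearrangement.nonempty {l m : List α} (h : l.Perm m) : Nonempty (Rearrangement l m) := by
  induction l generalizing m with
  | nil => rw [List.nil_perm.1 h]; exact ⟨.nil⟩
  | cons a l ih =>
    obtain ⟨s, t, rfl⟩ := List.append_of_mem (h.mem_iff.1 (List.mem_cons_self))
    obtain ⟨p⟩ := ih ((h.trans List.perm_middle).cons_inv)
    obtain ⟨i⟩ := Insertion.nonempty a s t
    exact ⟨.cons a p i⟩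

variable (X) in
/-- The symmetry isomorphism reordering the factors along a permutation of lists. It does not depend
on the chosen rearrangement when the list has no duplicates. -/
def permIso {l m : List α} (h : l.Perm m) : tensorList X l ≅ tensorList X m :=
  (Rearrangement.nonempty h).some.iso X

lemma permIso_eq {l m : List α} (hm : m.Nodup) (p : Rearrangement l m) :
    permIso X p.perm = p.iso X :=
  congrArg (Rearrangement.iso X) (Rearrangement.eq hm _ _)

lemma permIso_refl {l : List α} (hl : l.Nodup) : permIso X (.refl l) = Iso.refl _ := by
  have : ∃ p : Rearrangement l l, p.iso X = Iso.refl _ := by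
    clear hl
    induction l with
    | nil => exact ⟨.nil, rfl⟩
    | cons a l ih =>
      obtain ⟨p, hp⟩ := ih
      refine ⟨.cons a p (.here l), ?_⟩
      ext
      exact refl_cons (congrArg Iso.hom hp)
  obtain ⟨p, hp⟩ := this
  exact (permIso_eq hl p).trans hp

lemma permIso_trans {l m n : List α} (hn : n.Nodup) (h : l.Perm m) (h' : m.Perm n) :
    (permIso X h).hom ≫ (permIso X h').hom = (permIso X (h.trans h')).hom := by
  obtain ⟨r, hr⟩ := (Rearrangement.nonempty h).some.comp X (Rearrangement.nonempty h').some
  exact hr.symm.trans (congrArg Iso.hom (permIso_eq hn r)).symm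

lemma permIso_cast {l l' m : List α} (e : l = l') (h : l'.Perm m) (h' : l.Perm m) :
    eqToHom (congrArg (tensorList X) e) ≫ (permIso X h).hom = (permIso X h').hom := by
  subst e
  exact Category.id_comp _

variable {Y : β → C} {Z : γ → C}
/-- Tensor product of a list of morphisms -/
def mapList (σ : α → β) (f : ∀ a, X a ⟶ Y (σ a)) :
    (l : List α) → (tensorList X l ⟶ tensorList Y (l.map σ))
  | [] => 𝟙 _
  | a :: l => f a ⊗ₘ mapList σ f l

lemma Insertion.naturality (σ : α → β) (f : ∀ a, X a ⟶ Y (σ a)) {a : α} {l m : List α}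
    (i : Insertion a l m) : ∃ j : Insertion (σ a) (l.map σ) (m.map σ),
      mapList σ f m ≫ (j.iso Y).hom = (i.iso X).hom ≫ (f a ⊗ₘ mapList σ f l) := by
  induction i with
  | here l => exact ⟨.here _, (Category.comp_id _).trans (Category.id_comp _).symm⟩
  | there b i ih =>
    obtain ⟨j, hj⟩ := ih
    exact ⟨.there _ j, naturality_there hj⟩

lemma Rearrangement.naturality (σ : α → β) (f : ∀ a, X a ⟶ Y (σ a)) {l m : List α}
    (p : Rearrangement l m) : ∃ q : Rearrangement (l.map σ) (m.map σ),
      mapList σ f l ≫ (q.iso Y).hom = (p.iso X).hom ≫ mapList σ f m := by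
  induction p with
  | nil => exact ⟨.nil, (Category.comp_id _).trans (Category.id_comp _).symm⟩
  | cons a p i ih =>
    obtain ⟨q, hq⟩ := ih
    obtain ⟨j, hj⟩ := i.naturality σ f
    exact ⟨.cons _ q j, naturality_cons hq hj⟩

lemma permIso_naturality (σ : α → β) (f : ∀ a, X a ⟶ Y (σ a)) {l m : List α}
    (_hm : m.Nodup) (hm' : (m.map σ).Nodup) (h : l.Perm m) :
    (permIso X h).hom ≫ mapList σ f m = mapList σ f l ≫ (permIso Y (h.map σ)).hom := by
  obtain ⟨q, hq⟩ := (Rearrangement.nonempty h).some.naturality σ f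
  exact hq.symm.trans (congrArg (fun t => _ ≫ Iso.hom t) (permIso_eq hm' q).symm)

lemma mapList_comp_permIso (σ : α → β) (τ : β → γ) (f : ∀ a, X a ⟶ Y (σ a)) (g : ∀ b, Y b ⟶ Z (τ b))
    (l : List α) {m : List γ} (h : ((l.map σ).map τ).Perm m) (h' : (l.map (τ ∘ σ)).Perm m) :
    mapList σ f l ≫ mapList τ g (l.map σ) ≫ (permIso Z h).hom =
      mapList (X := X) (Y := Z) (τ ∘ σ) (fun a => f a ≫ g (σ a)) l ≫ (permIso Z h').hom := by
  have key : mapList σ f l ≫ mapList τ g (l.map σ) =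
      mapList (X := X) (Y := Z) (τ ∘ σ) (fun a => f a ≫ g (σ a)) l ≫
        eqToHom (congrArg (tensorList Z) (List.map_map ..).symm) := by
    clear h h'
    induction l with
    | nil => rfl
    | cons a l ih =>
      exact comp_cons_map ih (congrArg (fun t => Z (τ (σ a)) ⊗ tensorList Z t)
        (List.map_map ..).symm)
  rw [← Category.assoc, key, Category.assoc, permIso_cast (List.map_map ..).symm]
end

section Fin
variable [SymmetricCategory C] {n : ℕ}
/-- `X 0 ⊗ (X 1 ⊗ (⋯ ⊗ 𝟙))`. -/
abbrev tensorFin (X : Fin n → C) : C := tensorList X (List.finRange n)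

variable {X Y Z : Fin n → C}
lemma finRange_map_perm (σ : Equiv.Perm (Fin n)) : ((List.finRange n).map σ).Perm (List.finRange n) := by
  refine (List.perm_ext_iff_of_nodup ((List.nodup_finRange n).map σ.injective) (List.nodup_finRange n)).2 ?_
  exact fun a => ⟨fun _ => List.mem_finRange a,
    fun _ => List.mem_map.2 ⟨σ.symm a, List.mem_finRange _, σ.apply_symm_apply a⟩⟩

/-- Given morphisms `f i : X i ⟶ Y (σ i)`, apply all `f i` and then reorder the tensor factors by
the symmetry. -/
def tensorPerm (σ : Equiv.Perm (Fin n)) (f : ∀ i, X i ⟶ Y (σ i)) : tensorFin X ⟶ tensorFin Y :=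
  mapList σ f (List.finRange n) ≫ (permIso Y (finRange_map_perm σ)).hom

lemma tensorPerm_id : tensorPerm (X := X) (Y := X) (Equiv.refl _) (fun i => 𝟙 (X i)) = 𝟙 _ := by
  have h : ∀ l : List (Fin n), mapList (X := X) (Y := X) (Equiv.refl (Fin n)) (fun i => 𝟙 (X i)) l =
      eqToHom (congrArg (tensorList X) (List.map_id l).symm) := by
    intro l
    induction l with
    | nil => rfl
    | cons a l ih => exact id_cons_map ih (congrArg (fun t => X a ⊗ tensorList X t) (List.map_id l).symm)
  refine (congrArg (fun t => t ≫ _) (h _)).trans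
    ((permIso_cast (List.map_id _).symm (finRange_map_perm (Equiv.refl _)) (.refl _)).trans ?_)
  rw [permIso_refl (List.nodup_finRange n)]
  rfl

lemma tensorPerm_comp (σ τ : Equiv.Perm (Fin n)) (f : ∀ i, X i ⟶ Y (σ i)) (g : ∀ i, Y i ⟶ Z (τ i)) :
    tensorPerm σ f ≫ tensorPerm τ g = tensorPerm (Y := Z) (σ.trans τ) (fun i => f i ≫ g (σ i)) := by
  have hn := List.nodup_finRange n
  rw [tensorPerm, tensorPerm, Category.assoc, ← Category.assoc (permIso _ _).hom,
    permIso_naturality _ _ hn (hn.map τ.injective), Category.assoc, permIso_trans hn,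
    mapList_comp_permIso σ τ f g _ _ (finRange_map_perm (σ.trans τ))]
  rfl
end Fin
end
end UnorderedTensor

noncomputable section
namespace OperadTree
open PushoutProduct UnorderedTensor

/-- Finite rooted planar trees whose vertices are coloured (`true`) or uncoloured (`false`). The
trivial tree `|` without vertices is `leaf`; the tree `node c n T` has a root vertex of colour `c`
with `n` inputs, onto which the trees `T i` are grafted. A vertex may have no inputs. -/
inductive ColouredTree : Type
  | leaf : ColouredTree
  | node (coloured : Bool) (n : ℕ) (branch : Fin n → ColouredTree) : ColouredTree

namespace ColouredTree

/-- Isomorphisms of coloured trees, not required to respect the planar structure: a permutation of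
the inputs of the root, together with isomorphisms of the corresponding subtrees. -/
inductive Iso : ColouredTree → ColouredTree → Type
  | leaf : Iso .leaf .leaf
  | node (c : Bool) {n : ℕ} {s t : Fin n → ColouredTree} (σ : Equiv.Perm (Fin n))
      (φ : ∀ i, Iso (s i) (t (σ i))) : Iso (.node c n s) (.node c n t)

def Iso.id : (T : ColouredTree) → Iso T T
  | .leaf => .leaf
  | .node c _ s => .node c (Equiv.refl _) fun i => Iso.id (s i)

def Iso.comp : {R S T : ColouredTree} → Iso R S → Iso S T → Iso R T
  | _, _, _, .leaf, .leaf => .leaf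
  | _, _, _, .node c σ φ, .node _ τ ψ => .node c (σ.trans τ) fun i => (φ i).comp (ψ (σ i))

def Iso.inv : {S T : ColouredTree} → Iso S T → Iso T S
  | _, _, .leaf => .leaf
  | _, _, .node c (s := s) (t := t) σ φ =>
      .node c σ.symm fun j => cast (congrArg (fun k => Iso (t k) (s (σ.symm j))) (σ.apply_symm_apply j))
        (φ (σ.symm j)).inv

lemma Iso.id_comp {S T : ColouredTree} (φ : Iso S T) : (Iso.id S).comp φ = φ := by
  induction φ with
  | leaf => rfl
  | node c σ φ ih => exact congrArg (Iso.node c σ) (funext ih)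

lemma Iso.comp_id {S T : ColouredTree} (φ : Iso S T) : φ.comp (Iso.id T) = φ := by
  induction φ with
  | leaf => rfl
  | node c σ φ ih => exact congrArg (Iso.node c σ) (funext ih)

lemma Iso.assoc {Q R S T : ColouredTree} (φ : Iso Q R) (ψ : Iso R S) (χ : Iso S T) :
    (φ.comp ψ).comp χ = φ.comp (ψ.comp χ) := by
  induction φ generalizing S T with
  | leaf => cases ψ; cases χ; rfl
  | node c σ φ ih =>
    cases ψ with
    | node _ τ ψ =>
      cases χ with
      | node _ ρ χ => exact congrArg (Iso.node c _) (funext fun i => ih i _ _)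

lemma Iso.node_eq_id {c : Bool} {n : ℕ} {s : Fin n → ColouredTree} {ρ : Equiv.Perm (Fin n)}
    (h : ρ = Equiv.refl _) (χ : ∀ i, Iso (s i) (s (ρ i))) (hχ : ∀ i, HEq (χ i) (Iso.id (s i))) :
    Iso.node c ρ χ = Iso.id (.node c n s) := by
  subst h
  exact congrArg (Iso.node c _) (funext fun i => eq_of_heq (hχ i))

lemma Iso.comp_inv {S T : ColouredTree} (φ : Iso S T) : φ.comp φ.inv = Iso.id S := by
  induction φ with
  | leaf => rfl
  | node c σ φ ih =>
    rename_i n s t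
    refine Iso.node_eq_id (Equiv.self_trans_symm σ) _ fun i => ?_
    have : ∀ (k) (hk : k = i) (e : Iso (t (σ k)) (s k) = Iso (t (σ i)) (s k)),
        HEq ((φ i).comp (cast e (φ k).inv)) (Iso.id (s i)) := by
      rintro k rfl e
      exact heq_of_eq (ih k)
    exact this _ (σ.symm_apply_apply i) _

lemma Iso.inv_comp {S T : ColouredTree} (φ : Iso S T) : φ.inv.comp φ = Iso.id T := by
  induction φ with
  | leaf => rfl
  | node c σ φ ih =>
    rename_i n s t
    refine Iso.node_eq_id (Equiv.symm_trans_self σ) _ fun j => ?_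
    have : ∀ (k) (hk : σ (σ.symm j) = k) (e : Iso (t (σ (σ.symm j))) (s (σ.symm j)) =
        Iso (t k) (s (σ.symm j))), HEq ((cast e (φ (σ.symm j)).inv).comp (φ (σ.symm j))) (Iso.id (t k)) := by
      rintro k rfl e
      exact heq_of_eq (ih _)
    exact this _ (σ.apply_symm_apply j) _

/-- The groupoid of coloured trees; `Aut T` is the automorphism group of the coloured tree `T`. -/
instance : Groupoid ColouredTree where
  Hom := Iso
  id := Iso.id
  comp := Iso.comp
  inv := Iso.inv
  id_comp := Iso.id_comp
  comp_id := Iso.comp_id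
  assoc := Iso.assoc
  inv_comp := Iso.inv_comp
  comp_inv := Iso.comp_inv

section Labelling
variable {C : Type u} [Category.{v} C] [MonoidalCategory C] [SymmetricCategory C]
  (L : Bool → ∀ n : ℕ, Action C (Equiv.Perm (Fin n)))

/-- The tensor product of the labels `L c n` over the vertices of a tree (`c` the colour of the
vertex, `n` its number of inputs). -/
def labelObj : ColouredTree → C
  | .leaf => 𝟙_ C
  | .node c n s => (L c n).V ⊗ tensorFin fun i => labelObj (s i)

/-- Isomorphisms of trees act on the labels through the actions of the symmetric groups and by
permuting the tensor factors of the subtrees. -/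
def labelMap : {S T : ColouredTree} → Iso S T → (labelObj L S ⟶ labelObj L T)
  | _, _, .leaf => 𝟙 _
  | _, _, .node c (n := n) σ φ => (L c n).ρ σ ⊗ₘ tensorPerm σ fun i => labelMap (φ i)

/-- The labelling of trees as a functor on the groupoid of coloured trees. -/
def labelling : ColouredTree ⥤ C where
  obj := labelObj L
  map φ := labelMap L φ
  map_id T := by
    change labelMap L (Iso.id T) = 𝟙 _
    induction T with
    | leaf => rfl
    | node c n s ih =>
      have h1 : (L c n).ρ (Equiv.refl _) = 𝟙 _ := (L c n).ρ.map_one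
      have h2 : (fun i => labelMap L (Iso.id (s i))) = fun i => 𝟙 (labelObj L (s i)) := funext ih
      change ((L c n).ρ (Equiv.refl _) ⊗ₘ tensorPerm (X := fun i => labelObj L (s i))
        (Y := fun i => labelObj L (s i)) (Equiv.refl _) fun i => labelMap L (Iso.id (s i))) = _
      rw [h1]
      refine (congrArg (fun k => 𝟙 (L c n).V ⊗ₘ tensorPerm (X := fun i => labelObj L (s i))
        (Y := fun i => labelObj L (s i)) (Equiv.refl _) k) h2).trans ?_
      exact (congrArg _ tensorPerm_id).trans (MonoidalCategory.id_tensorHom_id _ _)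
  map_comp {R S T} φ ψ := by
    change Iso R S at φ
    change Iso S T at ψ
    change labelMap L (Iso.comp φ ψ) = labelMap L φ ≫ labelMap L ψ
    induction φ generalizing T with
    | leaf => cases ψ; exact (Category.comp_id _).symm
    | node c σ φ ih =>
      cases ψ with
      | node _ τ ψ =>
        rename_i n r s t
        have h1 : (L c _).ρ (σ.trans τ) = (L c _).ρ σ ≫ (L c _).ρ τ := (L c _).ρ.map_mul τ σ
        have h2 := fun i => ih i (ψ (σ i))
        refine Eq.trans ?_ (tensorHom_comp_tensorHom _ _ _ _).symm
        refine Eq.trans ?_ (congrArg _ (tensorPerm_comp _ _ _ _).symm)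
        change ((L c _).ρ (σ.trans τ) ⊗ₘ tensorPerm (X := fun i => labelObj L (r i))
          (Y := fun i => labelObj L (t i)) (σ.trans τ) fun i => labelMap L ((φ i).comp (ψ (σ i)))) = _
        rw [h1]
        exact congrArg (fun k => ((L c n).ρ σ ≫ (L c n).ρ τ) ⊗ₘ
          tensorPerm (X := fun i => labelObj L (r i)) (Y := fun i => labelObj L (t i))
            (σ.trans τ) k) (funext h2)
end Labelling

/-- A functor on trees gives an action of `Aut T`. -/
def autAction {C : Type u} [Category.{v} C] (F : ColouredTree ⥤ C) (T : ColouredTree) :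
    Action C (Aut T) where
  V := F.obj T
  ρ :=
    { toFun := fun g => F.map g.hom
      map_one' := F.map_id T
      map_mul' := fun g h => F.map_comp h.hom g.hom }

section Comparison
variable {E : Type u} [Category.{v} E] [MonoidalCategory E] [SymmetricCategory E]
  [MonoidalClosed E] [HasPushouts E] [HasInitial E]

/-- The target functor from the arrow category is compatible with tensor products of lists. -/
def rightTensorList {α : Type w} {X : α → Arrow E} {Y : α → E} (e : ∀ a, (X a).right ≅ Y a) :
    (l : List α) → ((tensorList X l).right ≅ tensorList Y l)
  | [] => Iso.refl _
  | a :: l => e a ⊗ᵢ rightTensorList e l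

lemma right_insertion {α : Type w} {X : α → Arrow E} {Y : α → E} (e : ∀ a, (X a).right ≅ Y a)
    {a : α} {l m : List α} (i : Insertion a l m) :
    (i.iso X).hom.right ≫ ((e a).hom ⊗ₘ (rightTensorList e l).hom) =
      (rightTensorList e m).hom ≫ (i.iso Y).hom := by
  induction i with
  | here l => exact (Category.id_comp _).trans (Category.comp_id _).symm
  | there b i ih => exact (naturality_there ih.symm).symm

lemma right_rearrangement {α : Type w} {X : α → Arrow E} {Y : α → E} (e : ∀ a, (X a).right ≅ Y a)
    {l m : List α} (p : Rearrangement l m) :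
    (p.iso X).hom.right ≫ (rightTensorList e m).hom =
      (rightTensorList e l).hom ≫ (p.iso Y).hom := by
  induction p with
  | nil => rfl
  | cons a p i ih =>
    exact (naturality_cons (j := i.iso Y) (i := Arrow.rightFunc.mapIso (i.iso X)) ih.symm (right_insertion e i).symm).symm

lemma right_mapList {α β : Type w} {X : α → Arrow E} {Y : α → E} {X' : β → Arrow E} {Y' : β → E}
    (e : ∀ a, (X a).right ≅ Y a) (e' : ∀ a, (X' a).right ≅ Y' a)
    (σ : α → β) (f : ∀ a, X a ⟶ X' (σ a)) (f' : ∀ a, Y a ⟶ Y' (σ a))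
    (h : ∀ a, (f a).right ≫ (e' (σ a)).hom = (e a).hom ≫ f' a) (l : List α) :
    (mapList σ f l).right ≫ (rightTensorList e' (l.map σ)).hom =
      (rightTensorList e l).hom ≫ mapList σ f' l := by
  induction l with
  | nil => rfl
  | cons a l ih =>
    exact (tensorHom_comp_tensorHom _ _ _ _).trans ((congrArg₂ (fun s t => s ⊗ₘ t) (h a) ih).trans
      (tensorHom_comp_tensorHom _ _ _ _).symm)

lemma right_tensorPerm {n : ℕ} {X X' : Fin n → Arrow E} {Y Y' : Fin n → E}
    (e : ∀ a, (X a).right ≅ Y a) (e' : ∀ a, (X' a).right ≅ Y' a)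
    (σ : Equiv.Perm (Fin n)) (f : ∀ a, X a ⟶ X' (σ a)) (f' : ∀ a, Y a ⟶ Y' (σ a))
    (h : ∀ a, (f a).right ≫ (e' (σ a)).hom = (e a).hom ≫ f' a) :
    (tensorPerm σ f).right ≫ (rightTensorList e' (List.finRange n)).hom =
      (rightTensorList e (List.finRange n)).hom ≫ tensorPerm σ f' := by
  have h1 := right_mapList e e' σ f f' h (List.finRange n)
  obtain ⟨p⟩ := Rearrangement.nonempty (finRange_map_perm σ)
  have h2 := right_rearrangement e' p
  rw [← permIso_eq (List.nodup_finRange n) p, ← permIso_eq (List.nodup_finRange n) p] at h2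
  exact (Category.assoc _ _ _).trans ((congrArg _ h2).trans ((Category.assoc _ _ _).symm.trans
    ((congrArg (fun t => t ≫ _) h1).trans (Category.assoc _ _ _))))

variable (L : Bool → ∀ n : ℕ, Action (Arrow E) (Equiv.Perm (Fin n)))
  (L' : Bool → ∀ n : ℕ, Action E (Equiv.Perm (Fin n)))

/-- The target of the tree labelled by arrows is the tree labelled by the targets. -/
def rightLabelIso (hV : ∀ c n, (L c n).V.right ≅ (L' c n).V) :
    (T : ColouredTree) → ((labelObj L T).right ≅ labelObj L' T)
  | .leaf => Iso.refl _
  | .node c n s => hV c n ⊗ᵢ rightTensorList (fun i => rightLabelIso hV (s i)) (List.finRange n)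

lemma rightLabelIso_naturality (hV : ∀ c n, (L c n).V.right ≅ (L' c n).V)
    (hρ : ∀ c n σ, ((L c n).ρ σ).right ≫ (hV c n).hom = (hV c n).hom ≫ (L' c n).ρ σ)
    {S T : ColouredTree} (φ : Iso S T) :
    (labelMap L φ).right ≫ (rightLabelIso L L' hV T).hom =
      (rightLabelIso L L' hV S).hom ≫ labelMap L' φ := by
  induction φ with
  | leaf => rfl
  | node c σ φ ih =>
    exact (tensorHom_comp_tensorHom _ _ _ _).trans ((congrArg₂ (fun s t => s ⊗ₘ t) (hρ c _ σ)
      (right_tensorPerm _ _ σ _ _ ih)).trans (tensorHom_comp_tensorHom _ _ _ _).symm)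
end Comparison
end ColouredTree

section Equivariant
variable {E : Type u} [Category.{v} E]

/-- Collections in `E`: sequences `(K(n))` of objects of `E`, each with an action of the symmetric
group on `n` letters. -/
abbrev Collection (E : Type u) [Category.{v} E] : Type (max u v) :=
  ∀ n : ℕ, Action E (Equiv.Perm (Fin n))

/-- The unit collection: the unit of `E` in degree `1`, the initial object in all other degrees. -/
def unitCollection (E : Type u) [Category.{v} E] [MonoidalCategory E] [HasInitial E] :
    Collection E
  | 1 => Action.trivial _ (𝟙_ E)
  | _ => Action.trivial _ (⊥_ E)

/-- A `G`-equivariant morphism regarded as an object of the arrow category with an action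
of `G`. -/
def arrowAction {G : Type w} [Group G] {K K' : Action E G} (f : K ⟶ K') : Action (Arrow E) G where
  V := Arrow.mk f.hom
  ρ :=
    { toFun := fun g => Arrow.homMk (K.ρ g) (K'.ρ g) (f.comm g)
      map_one' := Arrow.hom_ext _ _ K.ρ.map_one K'.ρ.map_one
      map_mul' := fun g h => Arrow.hom_ext _ _ (K.ρ.map_mul g h) (K'.ρ.map_mul g h) }

variable [HomotopicalAlgebra.ModelCategory E]

/-- The `G`-cofibrations of a model category `E`: the equivariant morphisms with the left lifting
property against all equivariant morphisms whose underlying morphism in `E` is a trivial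
fibration. -/
def IsEquivariantCofibration {G : Type w} [Group G] {K K' : Action E G} (f : K ⟶ K') : Prop :=
  ((HomotopicalAlgebra.trivialFibrations E).inverseImage (Action.forget E G)).llp f

/-- The cofibrations of collections: in each degree `n`, a cofibration of objects with an action
of the symmetric group on `n` letters. -/
def IsCollectionCofibration {K K' : Collection E} (f : K ⟶ K') : Prop :=
  ∀ n, IsEquivariantCofibration (f n)

/-- The pushout-product axiom. -/
structure PushoutProductAxiom (E : Type u) [Category.{v} E] [MonoidalCategory E]
    [HomotopicalAlgebra.ModelCategory E] : Prop where
  cofibration {A B X Y : E} (i : A ⟶ B) (j : X ⟶ Y) : HomotopicalAlgebra.Cofibration i →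
    HomotopicalAlgebra.Cofibration j → HomotopicalAlgebra.Cofibration (PushoutProduct.ι i j)
  weakEquivalence {A B X Y : E} (i : A ⟶ B) (j : X ⟶ Y) : HomotopicalAlgebra.Cofibration i →
    HomotopicalAlgebra.Cofibration j →
    HomotopicalAlgebra.WeakEquivalence i ∨ HomotopicalAlgebra.WeakEquivalence j →
    HomotopicalAlgebra.WeakEquivalence (PushoutProduct.ι i j)
end Equivariant

section LabelledTrees
open ColouredTree
variable {E : Type u} [Category.{v} E] [MonoidalCategory E] [SymmetricCategory E]

/-- The labels for the construction of `u(T, c)`: uncoloured vertices are labelled by `K₁`,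
coloured vertices by `K₂`. -/
def labels (K₁ K₂ : Collection E) : Bool → Collection E
  | false => K₁
  | true => K₂

/-- The object `u(T, c)` with its action of `Aut(T, c)`: the tensor product over the vertices `x`
of `T` of `K₁(n)` if `x` is uncoloured and `K₂(n)` if `x` is coloured, `n` being the number of
inputs of `x`. -/
def uObj (K₁ K₂ : Collection E) (T : ColouredTree) : Action E (Aut T) :=
  autAction (labelling (labels K₁ K₂)) T

section
variable [MonoidalClosed E] [HasPushouts E] [HasInitial E]
variable {K₁ K₂ : Collection E} (η : unitCollection E ⟶ K₁) (u : K₁ ⟶ K₂)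

/-- The arrows attached to the vertices: `η(n) : I(n) ⟶ K₁(n)` at uncoloured vertices with `n`
inputs (thus `I ⟶ K₁(1)` at the unary ones, `⊥ ⟶ K₁(n)` at the others), and `u(n) : K₁(n) ⟶ K₂(n)`
at coloured vertices. -/
def arrowLabels : Bool → Collection (Arrow E)
  | false, n => arrowAction (η n)
  | true, n => arrowAction (u n)

/-- The arrow `u^*(T, c) ⟶ u(T, c)`: the iterated pushout-product of the arrows attached to the
vertices of `T`. Unfolding the recursion, the arrow of `|` is `⊥ ⟶ I`, and if `T` has root arrow
`A ⟶ B` and subtrees `T₁, …, Tₙ` over the root, then `u^*(T, c) = B ⊗ v^* ∪ A ⊗ v` with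
`v = u(T₁) ⊗ ⋯ ⊗ u(Tₙ)` and `v^*` the union of the `u(T₁) ⊗ ⋯ ⊗ u^*(Tᵢ) ⊗ ⋯ ⊗ u(Tₙ)`. -/
def arrowLabelling : ColouredTree ⥤ Arrow E := labelling (arrowLabels η u)

/-- The target of the pushout-product construction is `u(T, c)`. -/
def targetIso (T : ColouredTree) : ((arrowLabelling η u).obj T).right ≅ (uObj K₁ K₂ T).V :=
  rightLabelIso (arrowLabels η u) (labels K₁ K₂)
    (fun c _ => match c with
      | false => Iso.refl _
      | true => Iso.refl _) T

/-- The object `u^*(T, c)` with its action of `Aut(T, c)`. -/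
def uStar (T : ColouredTree) : Action E (Aut T) :=
  autAction (arrowLabelling η u ⋙ Arrow.leftFunc) T

/-- The equivariant morphism `u^*(T, c) ⟶ u(T, c)`. -/
def uStarInclusion (T : ColouredTree) : uStar η u T ⟶ uObj K₁ K₂ T where
  hom := ((arrowLabelling η u).obj T).hom ≫ (targetIso η u T).hom
  comm g := by
    have h1 := ((arrowLabelling η u).map g.hom).w
    have h2 := rightLabelIso_naturality (arrowLabels η u) (labels K₁ K₂)
      (fun c _ => match c with
        | false => Iso.refl _
        | true => Iso.refl _)
      (fun c n σ => by cases c <;> exact (Category.comp_id _).trans (Category.id_comp _).symm) g.hom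
    exact (Category.assoc _ _ _).symm.trans ((congrArg (fun t => t ≫ _) h1).trans
      ((Category.assoc _ _ _).trans ((congrArg (fun t => _ ≫ t) h2).trans
        (Category.assoc _ _ _).symm)))
end
end LabelledTrees
end OperadTree
end

open OperadTree HomotopicalAlgebra

namespace OperadTree
open PushoutProduct UnorderedTensor HomotopicalAlgebra

/-! Let `T` have root label `y` and branches `T₁, …, Tₙ`, let `G = Aut T`, and let `π : G → Σₙ`
record the permutation of the root inputs. The arrow of `T` is the pushout-product of `x`, the
product of the branch arrows with its `G`-action, and of `y` with `G` acting through `π`. The kernel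
of `π` is `∏ Aut Tᵢ`, and it acts on `x` factor by factor. The theorem therefore reduces to a
statement about an arbitrary homomorphism `π : G → Q`, which is
`IsAdmissible.isArrowCofibration_tensor`: if `y` is a `Q`-cofibration, and `x` restricted to `ker π`
has the property that its pushout-product with every cofibration of `E` is a `ker π`-cofibration,
then `x □ π^*y` is a `G`-cofibration.

To prove it, write `x` as `i : X ⟶ Y` and let `p` be an equivariant morphism that is a trivial
fibration in `E`. By adjunction, lifting `i □ π^*y` against `p` amounts to lifting `y` against the
pullback-hom of `i` and `p`, coinduced along `π`. Since `y` is a `Q`-cofibration, it suffices that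
this pullback-hom is a trivial fibration in `E`, which is tested against cofibrations `k` without
any action. Such a test asks for a family of lifts indexed by `Q` and compatible with `G`. The group
`G` acts on `Q` by translation with all stabilizers equal to `ker π`, so one chooses a `ker
π`-equivariant lift on each orbit representative and translates it (`exists_equivariant_section`).

The induction over trees carries the weaker property `IsAdmissible` rather than being a cofibration.
The arrow `∅ ⟶ I` of the trivial tree is admissible even when `I` is not cofibrant, because it is
the unit for the pushout-product; and cofibrations are admissible by the pushout-product axiom
(`IsArrowCofibration.isAdmissible`). Admissibility passes to products of branches
(`isAdmissible_tensorList`), so a tree with a root vertex gives a genuine cofibration even if some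
of its branches are trivial (`isArrowCofibration_node`). -/

/-- Equivariant sections exist if there are sections fixed by the kernel: choose them on
representatives of the orbits of `G` on `Q`, and translate. -/
lemma exists_equivariant_section {G Q : Type*} {M : Type*} [Group G] [Group Q] (π : G →* Q)
    (act : G → M → M) (act_mul : ∀ g h m, act (g * h) m = act g (act h m))
    (S : Q → Set M) (hS : ∀ g σ, ∀ m ∈ S σ, act g m ∈ S (π g * σ))
    (hfix : ∀ σ, ∃ m ∈ S σ, ∀ g, π g = 1 → act g m = m) :
    ∃ s : Q → M, (∀ σ, s σ ∈ S σ) ∧ ∀ g σ, s (π g * σ) = act g (s σ) := by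
  choose m hm hm' using hfix
  -- The orbits of left translation by the image of `π` are its right cosets; `r σ` is the
  -- representative of the orbit of `σ`, and below `t σ` is an element of `G` carrying `r σ` to `σ`.
  let r : Q → Q := fun σ => (Quotient.mk (QuotientGroup.rightRel π.range) σ).out
  have hr : ∀ σ, ∃ g, π g * r σ = σ := fun σ => by
    have h : QuotientGroup.rightRel π.range (r σ) σ :=
      Quotient.mk_out (s := QuotientGroup.rightRel π.range) σ
    obtain ⟨g, hg⟩ := QuotientGroup.rightRel_apply.1 h
    exact ⟨g, by simp [hg]⟩
  choose t ht using hr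
  refine ⟨fun σ => act (t σ) (m (r σ)), fun σ => ?_, fun g σ => ?_⟩
  · have := hS (t σ) _ _ (hm (r σ))
    rwa [ht] at this
  · have e : r (π g * σ) = r σ := congrArg Quotient.out (Quotient.sound
      (QuotientGroup.rightRel_apply.2 ⟨g⁻¹, by simp⟩) :
        Quotient.mk (QuotientGroup.rightRel π.range) (π g * σ) = Quotient.mk _ σ)
    have h1 := ht (π g * σ)
    rw [e] at h1
    -- Both `g * t σ` and `t (π g * σ)` carry the common representative to `π g * σ`, so they differ
    -- by an element of the kernel, and this fixes the chosen point.
    have h2 : π ((g * t σ)⁻¹ * t (π g * σ)) = 1 := by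
      rw [map_mul, map_inv, map_mul, eq_mul_inv_of_mul_eq h1, eq_mul_inv_of_mul_eq (ht σ)]
      group
    have h3 : t (π g * σ) = g * t σ * ((g * t σ)⁻¹ * t (π g * σ)) := by group
    change act (t (π g * σ)) (m (r (π g * σ))) = act g (act (t σ) (m (r σ)))
    rw [e, h3, act_mul, hm' _ _ h2, act_mul]

/-! ### Internal homs coinduced along a homomorphism of finite groups -/

noncomputable section MappingObject
variable {E : Type u} [Category.{v} E] [MonoidalCategory E] [MonoidalClosed E]
  [HasFiniteLimits E] {G Q : Type} [Group G] [Group Q] [Finite G] [Finite Q]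

/-- The object of families `φ : Q → [Y, Z]` with `φ (π g * σ) = g φ(σ) g⁻¹`: the coinduction along
`π` of the internal hom. -/
def mapObj (π : G →* Q) (Y Z : Action E G) : E :=
  equalizer
    (Pi.lift fun a : G × Q => Pi.π (fun _ : Q => (ihom Y.V).obj Z.V) (π a.1 * a.2) ≫
      (MonoidalClosed.pre (Y.ρ a.1)).app Z.V)
    (Pi.lift fun a : G × Q => Pi.π (fun _ : Q => (ihom Y.V).obj Z.V) a.2 ≫
      (ihom Y.V).map (Z.ρ a.1))

/-- The inclusion of the object of equivariant families into the object of all families. -/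
def mapIncl (π : G →* Q) (Y Z : Action E G) :
    mapObj π Y Z ⟶ ∏ᶜ fun _ : Q => (ihom Y.V).obj Z.V := equalizer.ι _ _

variable (π : G →* Q) (Y Z : Action E G)

lemma mapIncl_condition (g : G) (σ : Q) :
    mapIncl π Y Z ≫ Pi.π (fun _ : Q => (ihom Y.V).obj Z.V) (π g * σ) ≫
        (MonoidalClosed.pre (Y.ρ g)).app Z.V =
      mapIncl π Y Z ≫ Pi.π (fun _ : Q => (ihom Y.V).obj Z.V) σ ≫ (ihom Y.V).map (Z.ρ g) := by
  have h := congrArg (fun t => t ≫ Pi.π _ (g, σ)) (equalizer.condition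
    (Pi.lift fun a : G × Q => Pi.π (fun _ : Q => (ihom Y.V).obj Z.V) (π a.1 * a.2) ≫
      (MonoidalClosed.pre (Y.ρ a.1)).app Z.V)
    (Pi.lift fun a : G × Q => Pi.π (fun _ : Q => (ihom Y.V).obj Z.V) a.2 ≫
      (ihom Y.V).map (Z.ρ a.1)))
  simp only [Category.assoc, Pi.lift_π] at h
  exact h

instance : Mono (mapIncl π Y Z) := inferInstanceAs (Mono (equalizer.ι _ _))

/-- The evaluation of a family at an element of `Q`. -/
def mapEval (σ : Q) : Y.V ⊗ mapObj π Y Z ⟶ Z.V :=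
  MonoidalClosed.uncurry (mapIncl π Y Z ≫ Pi.π (fun _ : Q => (ihom Y.V).obj Z.V) σ)

lemma mapEval_equivariant (g : G) (σ : Q) :
    Y.ρ g ▷ mapObj π Y Z ≫ mapEval π Y Z (π g * σ) = mapEval π Y Z σ ≫ Z.ρ g := by
  have h := congrArg MonoidalClosed.uncurry (mapIncl_condition π Y Z g σ)
  rw [← Category.assoc, ← Category.assoc, MonoidalClosed.uncurry_pre_app,
    MonoidalClosed.uncurry_natural_right] at h
  exact h

variable {π Y Z} {S : E}

/-- Morphisms into `mapObj π Y Z` are equivariant families of morphisms `Y ⊗ S ⟶ Z`. -/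
def mapLift (φ : Q → (Y.V ⊗ S ⟶ Z.V))
    (h : ∀ g σ, Y.ρ g ▷ S ≫ φ (π g * σ) = φ σ ≫ Z.ρ g) : S ⟶ mapObj π Y Z :=
  equalizer.lift (Pi.lift fun σ => MonoidalClosed.curry (φ σ)) (by
    refine Pi.hom_ext _ _ fun a => ?_
    have e1 := MonoidalClosed.curry_pre_app (Y.ρ a.1) (φ (π a.1 * a.2))
    have e2 := MonoidalClosed.curry_natural_right (φ a.2) (Z.ρ a.1)
    rw [h] at e1
    simp only [Category.assoc, Pi.lift_π, Pi.lift_π_assoc]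
    exact e1.trans e2)

lemma mapLift_incl (φ : Q → (Y.V ⊗ S ⟶ Z.V))
    (h : ∀ g σ, Y.ρ g ▷ S ≫ φ (π g * σ) = φ σ ≫ Z.ρ g) :
    mapLift φ h ≫ mapIncl π Y Z = Pi.lift fun σ => MonoidalClosed.curry (φ σ) :=
  equalizer.lift_ι _ _

lemma mapLift_eval (φ : Q → (Y.V ⊗ S ⟶ Z.V))
    (h : ∀ g σ, Y.ρ g ▷ S ≫ φ (π g * σ) = φ σ ≫ Z.ρ g) (σ : Q) :
    Y.V ◁ mapLift φ h ≫ mapEval π Y Z σ = φ σ := by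
  rw [mapEval, ← MonoidalClosed.uncurry_natural_left, reassoc_of% mapLift_incl φ h,
    Pi.lift_π, MonoidalClosed.uncurry_curry]

/-- Together with `mapLift_eval` this is the universal property of `mapObj`: identities between
morphisms into it can be checked on evaluations. -/
lemma map_hom_ext {a b : S ⟶ mapObj π Y Z}
    (h : ∀ σ, Y.V ◁ a ≫ mapEval π Y Z σ = Y.V ◁ b ≫ mapEval π Y Z σ) : a = b := by
  rw [← cancel_mono (mapIncl π Y Z)]
  refine Pi.hom_ext _ _ fun σ => ?_
  have := h σ
  rw [mapEval, ← MonoidalClosed.uncurry_natural_left, ← MonoidalClosed.uncurry_natural_left] at this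
  rw [Category.assoc, Category.assoc]
  exact MonoidalClosed.uncurry_injective this

variable (π Y Z) in
/-- The translation of families by an element of `Q`. -/
def mapTranslate (τ : Q) : mapObj π Y Z ⟶ mapObj π Y Z :=
  mapLift (fun σ => mapEval π Y Z (σ * τ)) fun g σ => by
    -- Right translation by `τ` commutes with left translation by `π g`, so it preserves the
    -- equivariance of families.
    rw [mul_assoc]; exact mapEval_equivariant π Y Z g _

lemma mapTranslate_eval (τ σ : Q) :
    Y.V ◁ mapTranslate π Y Z τ ≫ mapEval π Y Z σ = mapEval π Y Z (σ * τ) :=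
  mapLift_eval _ _ _

variable (π Y Z) in
/-- `mapObj π Y Z` with the action of `Q` by translation of families. -/
abbrev mapAction : Action E Q where
  V := mapObj π Y Z
  ρ :=
    { toFun := fun τ => mapTranslate π Y Z τ
      map_one' := map_hom_ext fun σ => by
        rw [mapTranslate_eval, mul_one]
        exact (by simp : mapEval π Y Z σ = Y.V ◁ 𝟙 _ ≫ mapEval π Y Z σ)
      map_mul' := fun τ τ' => map_hom_ext fun σ => by
        rw [mapTranslate_eval]
        change _ = Y.V ◁ (mapTranslate π Y Z τ' ≫ mapTranslate π Y Z τ) ≫ _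
        rw [MonoidalCategory.whiskerLeft_comp, Category.assoc, mapTranslate_eval,
          mapTranslate_eval, mul_assoc] }

variable {Y' Z' : Action E G}

/-- Functoriality of `mapObj` in both variables. -/
def mapMapHom (π : G →* Q) (y : Y' ⟶ Y) (z : Z ⟶ Z') : mapObj π Y Z ⟶ mapObj π Y' Z' :=
  mapLift (fun σ => y.hom ▷ mapObj π Y Z ≫ mapEval π Y Z σ ≫ z.hom) fun g σ => by
    have h1 := congrArg (fun t => t ▷ mapObj π Y Z) (y.comm g)
    simp only [comp_whiskerRight] at h1
    rw [reassoc_of% h1, reassoc_of% (mapEval_equivariant π Y Z g σ), Category.assoc,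
      Category.assoc, z.comm]

lemma mapMapHom_eval (y : Y' ⟶ Y) (z : Z ⟶ Z') (σ : Q) :
    Y'.V ◁ mapMapHom π y z ≫ mapEval π Y' Z' σ =
      y.hom ▷ mapObj π Y Z ≫ mapEval π Y Z σ ≫ z.hom :=
  mapLift_eval _ _ _

/-- Functoriality of `mapAction` in both variables. -/
def mapMap (π : G →* Q) (y : Y' ⟶ Y) (z : Z ⟶ Z') : mapAction π Y Z ⟶ mapAction π Y' Z' where
  hom := mapMapHom π y z
  comm τ := map_hom_ext fun σ => by
    change Y'.V ◁ (mapTranslate π Y Z τ ≫ mapMapHom π y z) ≫ _ =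
      Y'.V ◁ (mapMapHom π y z ≫ mapTranslate π Y' Z' τ) ≫ _
    rw [MonoidalCategory.whiskerLeft_comp, Category.assoc, MonoidalCategory.whiskerLeft_comp,
      Category.assoc, mapTranslate_eval, mapMapHom_eval, mapMapHom_eval,
      ← mapTranslate_eval (Y := Y) (Z := Z) τ σ, whisker_exchange_assoc, Category.assoc]

end MappingObject

/-! ### Arrows with a group action: cofibrations and admissibility -/

noncomputable section ArrowActions
variable {E : Type u} [Category.{v} E] {G : Type} [Group G]

/-- The source of an arrow with an action of `G`. -/
def sourceAction (x : Action (Arrow E) G) : Action E G := (Arrow.leftFunc.mapAction G).obj x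

/-- The target of an arrow with an action of `G`. -/
def targetAction (x : Action (Arrow E) G) : Action E G := (Arrow.rightFunc.mapAction G).obj x

/-- An arrow with an action of `G` as an equivariant morphism. -/
def equivariantHom (x : Action (Arrow E) G) : sourceAction x ⟶ targetAction x where
  hom := x.V.hom
  comm g := (x.ρ g).w

variable [ModelCategory E]

/-- An arrow with an action of `G` is a cofibration if it is a `G`-cofibration. -/
def IsArrowCofibration (x : Action (Arrow E) G) : Prop :=
  IsEquivariantCofibration (equivariantHom x)

/-- The lifting property in terms of morphisms of `E` and explicit equivariance conditions, the form
in which lifts are constructed later. -/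
lemma isArrowCofibration_iff (x : Action (Arrow E) G) : IsArrowCofibration x ↔
    ∀ (Z W : Action E G) (p : Z ⟶ W), trivialFibrations E p.hom →
      ∀ (a : x.V.left ⟶ Z.V) (b : x.V.right ⟶ W.V),
        (∀ g, (x.ρ g).left ≫ a = a ≫ Z.ρ g) → (∀ g, (x.ρ g).right ≫ b = b ≫ W.ρ g) →
        a ≫ p.hom = x.V.hom ≫ b →
        ∃ l : x.V.right ⟶ Z.V, (∀ g, (x.ρ g).right ≫ l = l ≫ Z.ρ g) ∧
          x.V.hom ≫ l = a ∧ l ≫ p.hom = b := by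
  constructor
  · intro h Z W p hp a b ha hb w
    have hl := h p hp
    let s : sourceAction x ⟶ Z := ⟨a, ha⟩
    let t : targetAction x ⟶ W := ⟨b, hb⟩
    have sq : CommSq s (equivariantHom x) p t := ⟨Action.hom_ext _ _ w⟩
    exact ⟨sq.lift.hom, sq.lift.comm, congrArg Action.Hom.hom sq.fac_left,
      congrArg Action.Hom.hom sq.fac_right⟩
  · intro h Z W p hp
    refine ⟨fun {s t} sq => ?_⟩
    obtain ⟨l, hl, h1, h2⟩ := h Z W p hp s.hom t.hom s.comm t.comm
      (congrArg Action.Hom.hom sq.w)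
    exact ⟨⟨⟨⟨l, hl⟩, Action.hom_ext _ _ h1, Action.hom_ext _ _ h2⟩⟩⟩

lemma IsArrowCofibration.of_iso {x y : Action (Arrow E) G} (e : x ≅ y)
    (h : IsArrowCofibration x) : IsArrowCofibration y := by
  rw [isArrowCofibration_iff] at h ⊢
  intro Z W p hp a b ha hb w
  have c := fun g => e.hom.comm g
  have c' := fun g => e.inv.comm g
  have e1 : e.hom.hom ≫ e.inv.hom = 𝟙 _ := congrArg Action.Hom.hom e.hom_inv_id
  have e2 : e.inv.hom ≫ e.hom.hom = 𝟙 _ := congrArg Action.Hom.hom e.inv_hom_id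
  have cl := fun g => congrArg CommaMorphism.left (c g)
  have cr := fun g => congrArg CommaMorphism.right (c g)
  have cr' := fun g => congrArg CommaMorphism.right (c' g)
  have e2l := congrArg CommaMorphism.left e2
  have e2r := congrArg CommaMorphism.right e2
  simp only [Arrow.comp_left, Arrow.comp_right, Arrow.id_left, Arrow.id_right]
    at cl cr cr' e2l e2r
  obtain ⟨l, hl, h1, h2⟩ := h Z W p hp (e.hom.hom.left ≫ a) (e.hom.hom.right ≫ b)
    (fun g => by rw [reassoc_of% (cl g), ha, Category.assoc])
    (fun g => by rw [reassoc_of% (cr g), hb, Category.assoc])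
    (by rw [Category.assoc, w]; exact (Arrow.w_assoc e.hom.hom b))
  refine ⟨e.inv.hom.right ≫ l, fun g => ?_, ?_, ?_⟩
  · rw [reassoc_of% (cr' g), hl, Category.assoc]
  · have := Arrow.w_assoc e.inv.hom l
    refine this.symm.trans ?_
    rw [h1, reassoc_of% e2l]
  · rw [Category.assoc, h2, reassoc_of% e2r]

variable [MonoidalCategory E] [SymmetricCategory E] [MonoidalClosed E]

/-- The arrows with an action of `G` whose pushout-products with cofibrations of `E` are
`G`-cofibrations. -/
def IsAdmissible (x : Action (Arrow E) G) : Prop :=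
  ∀ k : Arrow E, Cofibration k.hom → IsArrowCofibration (x ⊗ Action.trivial G k)

lemma IsAdmissible.of_iso {x y : Action (Arrow E) G} (e : x ≅ y)
    (h : IsAdmissible x) : IsAdmissible y :=
  fun k hk => (h k hk).of_iso (whiskerRightIso e _)

lemma inl_tensor_ρ (x y : Action (Arrow E) G) (g : G) :
    PushoutProduct.inl x.V.hom y.V.hom ≫ ((x ⊗ y).ρ g).left =
      ((x.ρ g).right ⊗ₘ (y.ρ g).left) ≫ PushoutProduct.inl x.V.hom y.V.hom :=
  PushoutProduct.inl_map _ _ (x.ρ g).w _ _ (y.ρ g).w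

lemma inr_tensor_ρ (x y : Action (Arrow E) G) (g : G) :
    PushoutProduct.inr x.V.hom y.V.hom ≫ ((x ⊗ y).ρ g).left =
      ((x.ρ g).left ⊗ₘ (y.ρ g).right) ≫ PushoutProduct.inr x.V.hom y.V.hom :=
  PushoutProduct.inr_map _ _ (x.ρ g).w _ _ (y.ρ g).w

/-- A pushout-product is a `G`-cofibration if and only if it has the extension property for
compatible equivariant maps on the two pieces of its source. -/
lemma isArrowCofibration_tensor_iff (x y : Action (Arrow E) G) : IsArrowCofibration (x ⊗ y) ↔
    ∀ (Z W : Action E G) (p : Z ⟶ W), trivialFibrations E p.hom →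
      ∀ (a : x.V.right ⊗ y.V.left ⟶ Z.V) (b : x.V.left ⊗ y.V.right ⟶ Z.V)
        (c : x.V.right ⊗ y.V.right ⟶ W.V),
        (∀ g, ((x.ρ g).right ⊗ₘ (y.ρ g).left) ≫ a = a ≫ Z.ρ g) →
        (∀ g, ((x.ρ g).left ⊗ₘ (y.ρ g).right) ≫ b = b ≫ Z.ρ g) →
        (∀ g, ((x.ρ g).right ⊗ₘ (y.ρ g).right) ≫ c = c ≫ W.ρ g) →
        x.V.hom ▷ y.V.left ≫ a = x.V.left ◁ y.V.hom ≫ b →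
        a ≫ p.hom = x.V.right ◁ y.V.hom ≫ c → b ≫ p.hom = x.V.hom ▷ y.V.right ≫ c →
        ∃ l : x.V.right ⊗ y.V.right ⟶ Z.V,
          (∀ g, ((x.ρ g).right ⊗ₘ (y.ρ g).right) ≫ l = l ≫ Z.ρ g) ∧
          x.V.right ◁ y.V.hom ≫ l = a ∧ x.V.hom ▷ y.V.right ≫ l = b ∧ l ≫ p.hom = c := by
  rw [isArrowCofibration_iff]
  constructor
  · intro h Z W p hp a b c ha hb hc hab hac hbc
    obtain ⟨l, hl, h1, h2⟩ := h Z W p hp (PushoutProduct.desc a b hab) c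
      (fun g => PushoutProduct.hom_ext
        ((Category.assoc _ _ _).symm.trans ((congrArg (fun t => t ≫ _)
          (inl_tensor_ρ x y g)).trans ((Category.assoc _ _ _).trans ((congrArg (fun t => _ ≫ t)
          (PushoutProduct.inl_desc _ _ _)).trans ((ha g).trans
          (PushoutProduct.inl_desc_assoc _ _ _ _).symm)))))
        ((Category.assoc _ _ _).symm.trans ((congrArg (fun t => t ≫ _)
          (inr_tensor_ρ x y g)).trans ((Category.assoc _ _ _).trans ((congrArg (fun t => _ ≫ t)
          (PushoutProduct.inr_desc _ _ _)).trans ((hb g).trans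
          (PushoutProduct.inr_desc_assoc _ _ _ _).symm))))))
      hc
      (PushoutProduct.hom_ext
        ((PushoutProduct.inl_desc_assoc _ _ _ _).trans (hac.trans
          (PushoutProduct.inl_ι_assoc _ _ _).symm))
        ((PushoutProduct.inr_desc_assoc _ _ _ _).trans (hbc.trans
          (PushoutProduct.inr_ι_assoc _ _ _).symm)))
    refine ⟨l, hl, ?_, ?_, h2⟩
    · exact (PushoutProduct.inl_ι_assoc _ _ _).symm.trans
        ((congrArg (fun t => PushoutProduct.inl _ _ ≫ t) h1).trans (PushoutProduct.inl_desc _ _ _))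
    · exact (PushoutProduct.inr_ι_assoc _ _ _).symm.trans
        ((congrArg (fun t => PushoutProduct.inr _ _ ≫ t) h1).trans (PushoutProduct.inr_desc _ _ _))
  · intro h Z W p hp s c hs hc w
    have hl := fun g => congrArg (fun t => PushoutProduct.inl x.V.hom y.V.hom ≫ t) (hs g)
    have hr := fun g => congrArg (fun t => PushoutProduct.inr x.V.hom y.V.hom ≫ t) (hs g)
    obtain ⟨l, hl, h1, h2, h3⟩ := h Z W p hp (PushoutProduct.inl x.V.hom y.V.hom ≫ s)
      (PushoutProduct.inr x.V.hom y.V.hom ≫ s) c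
      (fun g => (Category.assoc _ _ _).symm.trans ((congrArg (fun t => t ≫ s)
        (inl_tensor_ρ x y g)).symm.trans ((Category.assoc _ _ _).trans ((hl g).trans
          (Category.assoc _ _ _).symm))))
      (fun g => (Category.assoc _ _ _).symm.trans ((congrArg (fun t => t ≫ s)
        (inr_tensor_ρ x y g)).symm.trans ((Category.assoc _ _ _).trans ((hr g).trans
          (Category.assoc _ _ _).symm)))) hc
      ((Category.assoc _ _ _).symm.trans ((congrArg (fun t => t ≫ s)
        (PushoutProduct.cond x.V.hom y.V.hom)).trans (Category.assoc _ _ _)))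
      ((Category.assoc _ _ _).trans ((congrArg (fun t => PushoutProduct.inl _ _ ≫ t) w).trans
        (PushoutProduct.inl_ι_assoc _ _ _)))
      ((Category.assoc _ _ _).trans ((congrArg (fun t => PushoutProduct.inr _ _ ≫ t) w).trans
        (PushoutProduct.inr_ι_assoc _ _ _)))
    exact ⟨l, hl, PushoutProduct.hom_ext ((PushoutProduct.inl_ι_assoc _ _ _).trans h1)
      ((PushoutProduct.inr_ι_assoc _ _ _).trans h2), h3⟩

/-! ### Lifting relative to the kernel, and the coinduced pullback-hom -/

section Core
variable {K Q : Type} [Group K] [Group Q] {π : G →* Q} {j : K →* G}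
variable {x : Action (Arrow E) G}

/-- The extension property of the pushout-product of `i` and `k` against `p`, for maps which
are equivariant under the kernel of `π`. -/
def HasKernelLifting (π : G →* Q) {X Y Z W : Action E G} (i : X ⟶ Y) {C D : E} (k : C ⟶ D)
    (p : Z ⟶ W) : Prop :=
  ∀ (a : Y.V ⊗ C ⟶ Z.V) (b : X.V ⊗ D ⟶ Z.V) (c : Y.V ⊗ D ⟶ W.V),
    (∀ g, π g = 1 → Y.ρ g ▷ C ≫ a = a ≫ Z.ρ g) →
    (∀ g, π g = 1 → X.ρ g ▷ D ≫ b = b ≫ Z.ρ g) →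
    (∀ g, π g = 1 → Y.ρ g ▷ D ≫ c = c ≫ W.ρ g) →
    i.hom ▷ C ≫ a = X.V ◁ k ≫ b → a ≫ p.hom = Y.V ◁ k ≫ c → b ≫ p.hom = i.hom ▷ D ≫ c →
    ∃ l : Y.V ⊗ D ⟶ Z.V, (∀ g, π g = 1 → Y.ρ g ▷ D ≫ l = l ≫ Z.ρ g) ∧
      Y.V ◁ k ≫ l = a ∧ i.hom ▷ D ≫ l = b ∧ l ≫ p.hom = c

/-- Equivariance under `ker π` is equivariance under `K` after restriction along `j`, so the lifting
problem is one for the pushout-product of the restricted arrow with `k`, where `K` acts trivially on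
`k`. Only the range of `j` matters, not its injectivity. -/
lemma IsAdmissible.hasKernelLifting (hj : ∀ g, π g = 1 ↔ g ∈ j.range)
    (hx : IsAdmissible ((Action.res _ j).obj x)) {C D : E} (k : C ⟶ D) (hk : Cofibration k)
    {Z W : Action E G} (p : Z ⟶ W) (hp : trivialFibrations E p.hom) :
    HasKernelLifting π (equivariantHom x) k p := by
  intro a b c ha hb hc hab hac hbc
  have h := (isArrowCofibration_tensor_iff _ _).1 (hx (Arrow.mk k) hk)
  obtain ⟨l, hl, h123⟩ := h _ _ ((Action.res _ j).map p) hp a b c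
    (fun g => (congrArg (fun t => t ≫ a) (tensorHom_id _ _)).trans (ha _ ((hj _).2 ⟨g, rfl⟩)))
    (fun g => (congrArg (fun t => t ≫ b) (tensorHom_id _ _)).trans (hb _ ((hj _).2 ⟨g, rfl⟩)))
    (fun g => (congrArg (fun t => t ≫ c) (tensorHom_id _ _)).trans (hc _ ((hj _).2 ⟨g, rfl⟩)))
    hab hac hbc
  refine ⟨l, fun g hg => ?_, h123⟩
  obtain ⟨g, rfl⟩ := (hj _).1 hg
  exact (congrArg (fun t => t ≫ l) (tensorHom_id _ _).symm).trans (hl g)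

variable [Finite G] [Finite Q]

lemma mapMap_comm {X Y Z W : Action E G} (π : G →* Q) (i : X ⟶ Y) (p : Z ⟶ W) :
    mapMap π (𝟙 Y) p ≫ mapMap π i (𝟙 W) = mapMap π i (𝟙 Z) ≫ mapMap π (𝟙 X) p := by
  refine Action.hom_ext _ _ (map_hom_ext fun σ => ?_)
  change X.V ◁ (mapMapHom π (𝟙 Y) p ≫ mapMapHom π i (𝟙 W)) ≫ _ =
    X.V ◁ (mapMapHom π i (𝟙 Z) ≫ mapMapHom π (𝟙 X) p) ≫ _
  rw [MonoidalCategory.whiskerLeft_comp, Category.assoc, mapMapHom_eval, whisker_exchange_assoc,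
    reassoc_of% mapMapHom_eval (𝟙 Y) p σ, MonoidalCategory.whiskerLeft_comp, Category.assoc,
    mapMapHom_eval, whisker_exchange_assoc, reassoc_of% mapMapHom_eval i (𝟙 Z) σ]
  simp

/-- The pullback-hom of `i : X ⟶ Y` and `p : Z ⟶ W`, coinduced along `π`. -/
def pullbackHom {X Y Z W : Action E G} (π : G →* Q) (i : X ⟶ Y) (p : Z ⟶ W) :
    mapAction π Y Z ⟶ pullback (mapMap π i (𝟙 W)) (mapMap π (𝟙 X) p) :=
  pullback.lift (mapMap π (𝟙 Y) p) (mapMap π i (𝟙 Z)) (mapMap_comm π i p)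

end Core
end ArrowActions

/-! ### Pushout-product of a kernel-admissible arrow with a `Q`-cofibration -/

noncomputable section CoreLemma
variable {E : Type u} [Category.{v} E] {G : Type} [Group G]

lemma ρ_mul (Z : Action E G) (g h : G) : Z.ρ (g * h) = Z.ρ h ≫ Z.ρ g := Z.ρ.map_mul g h

lemma ρ_comp_inv (Z : Action E G) (g : G) : Z.ρ g ≫ Z.ρ g⁻¹ = 𝟙 Z.V := by
  rw [← ρ_mul, inv_mul_cancel]
  exact Z.ρ.map_one

lemma ρ_inv_comp (Z : Action E G) (g : G) : Z.ρ g⁻¹ ≫ Z.ρ g = 𝟙 Z.V := by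
  rw [← ρ_mul, mul_inv_cancel]
  exact Z.ρ.map_one

variable [MonoidalCategory E]

/-- The conjugation action on morphisms `Y ⊗ D ⟶ Z`. -/
def conjugate (Y Z : Action E G) (D : E) (g : G) (m : Y.V ⊗ D ⟶ Z.V) : Y.V ⊗ D ⟶ Z.V :=
  Y.ρ g⁻¹ ▷ D ≫ m ≫ Z.ρ g

lemma conjugate_mul (Y Z : Action E G) (D : E) (g h : G) (m : Y.V ⊗ D ⟶ Z.V) :
    conjugate Y Z D (g * h) m = conjugate Y Z D g (conjugate Y Z D h m) := by
  simp only [conjugate, mul_inv_rev, ρ_mul, comp_whiskerRight, Category.assoc]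

/-- Passes between the conjugation action required by `exists_equivariant_section` and the
inverse-free equivariance condition required by `mapLift`. -/
lemma eq_conjugate_iff (Y Z : Action E G) (D : E) (g : G) (m m' : Y.V ⊗ D ⟶ Z.V) :
    m' = conjugate Y Z D g m ↔ Y.ρ g ▷ D ≫ m' = m ≫ Z.ρ g := by
  constructor
  · rintro rfl
    rw [conjugate, ← comp_whiskerRight_assoc, ρ_comp_inv, id_whiskerRight, Category.id_comp]
  · intro h
    rw [conjugate, ← h, ← comp_whiskerRight_assoc, ρ_inv_comp, id_whiskerRight, Category.id_comp]

variable [ModelCategory E] [SymmetricCategory E] [MonoidalClosed E]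
variable {K Q : Type} [Group K] [Group Q] {π : G →* Q} {j : K →* G}
variable {x : Action (Arrow E) G} [Finite G] [Finite Q]

lemma comp_mapMapHom_eval {Y Y' Z Z' : Action E G} {S : E} (s : S ⟶ mapObj π Y Z)
    (y : Y' ⟶ Y) (z : Z ⟶ Z') (σ : Q) :
    Y'.V ◁ (s ≫ mapMapHom π y z) ≫ mapEval π Y' Z' σ =
      y.hom ▷ S ≫ (Y.V ◁ s ≫ mapEval π Y Z σ) ≫ z.hom := by
  rw [MonoidalCategory.whiskerLeft_comp, Category.assoc, mapMapHom_eval, whisker_exchange_assoc,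
    Category.assoc]

lemma comp_mapMapHom_eval_left {Y Y' Z : Action E G} {S : E} (s : S ⟶ mapObj π Y Z)
    (y : Y' ⟶ Y) (σ : Q) :
    Y'.V ◁ (s ≫ mapMapHom π y (𝟙 Z)) ≫ mapEval π Y' Z σ =
      y.hom ▷ S ≫ Y.V ◁ s ≫ mapEval π Y Z σ := by
  rw [comp_mapMapHom_eval, Action.id_hom, Category.comp_id]

lemma comp_mapMapHom_eval_right {Y Z Z' : Action E G} {S : E} (s : S ⟶ mapObj π Y Z)
    (z : Z ⟶ Z') (σ : Q) :
    Y.V ◁ (s ≫ mapMapHom π (𝟙 Y) z) ≫ mapEval π Y Z' σ =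
      (Y.V ◁ s ≫ mapEval π Y Z σ) ≫ z.hom := by
  rw [comp_mapMapHom_eval, Action.id_hom, id_whiskerRight, Category.id_comp]

lemma comp_eval_equivariant {Y Z : Action E G} {S : E} (s : S ⟶ mapObj π Y Z) (g : G) (σ : Q) :
    Y.ρ g ▷ S ≫ Y.V ◁ s ≫ mapEval π Y Z (π g * σ) = (Y.V ◁ s ≫ mapEval π Y Z σ) ≫ Z.ρ g := by
  rw [← whisker_exchange_assoc, mapEval_equivariant, Category.assoc]

/-- If `k` lifts in the sense of `HasKernelLifting`, then it lifts against the underlying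
pullback-hom. -/
lemma HasKernelLifting.exists_mapObj_lift {X Y Z W : Action E G} {i : X ⟶ Y} {C D : E} {k : C ⟶ D}
    {p : Z ⟶ W} (h : HasKernelLifting π i k p)
    (s : C ⟶ mapObj π Y Z) (t₁ : D ⟶ mapObj π Y W) (t₂ : D ⟶ mapObj π X Z)
    (h₁ : s ≫ mapMapHom π (𝟙 Y) p = k ≫ t₁) (h₂ : s ≫ mapMapHom π i (𝟙 Z) = k ≫ t₂)
    (h₃ : t₁ ≫ mapMapHom π i (𝟙 W) = t₂ ≫ mapMapHom π (𝟙 X) p) :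
    ∃ l : D ⟶ mapObj π Y Z, k ≫ l = s ∧ l ≫ mapMapHom π (𝟙 Y) p = t₁ ∧
      l ≫ mapMapHom π i (𝟙 Z) = t₂ := by
  -- `S σ` is the set of solutions of the lifting problem in the component `σ`, with no equivariance
  -- imposed. A lift into `mapObj` is a section of `S` that is equivariant for conjugation.
  let S : Q → Set (Y.V ⊗ D ⟶ Z.V) := fun σ => {m | Y.V ◁ k ≫ m = Y.V ◁ s ≫ mapEval π Y Z σ ∧
    i.hom ▷ D ≫ m = X.V ◁ t₂ ≫ mapEval π X Z σ ∧ m ≫ p.hom = Y.V ◁ t₁ ≫ mapEval π Y W σ}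
  -- The data `s`, `t₁`, `t₂` are equivariant families, so conjugation by `g` carries the problem at
  -- `σ` to the problem at `π g * σ`.
  have hS : ∀ g σ, ∀ m ∈ S σ, conjugate Y Z D g m ∈ S (π g * σ) := by
    rintro g σ m ⟨e1, e2, e3⟩
    refine ⟨?_, ?_, ?_⟩
    · rw [conjugate, whisker_exchange_assoc, reassoc_of% e1, ← Category.assoc (Y.V ◁ s),
        ← comp_eval_equivariant, ← comp_whiskerRight_assoc, ρ_inv_comp, id_whiskerRight,
        Category.id_comp]
    · rw [conjugate, ← comp_whiskerRight_assoc, ← i.comm, comp_whiskerRight, Category.assoc,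
        reassoc_of% e2, ← Category.assoc (X.V ◁ t₂),
        ← comp_eval_equivariant, ← comp_whiskerRight_assoc, ρ_inv_comp, id_whiskerRight,
        Category.id_comp]
    · rw [conjugate, Category.assoc, Category.assoc, p.comm, reassoc_of% e3,
        ← Category.assoc (Y.V ◁ t₁), ← comp_eval_equivariant, ← comp_whiskerRight_assoc,
        ρ_inv_comp, id_whiskerRight, Category.id_comp]
  -- For `g` in the kernel, `π g * σ = σ`, so the equivariance of a family becomes
  -- kernel-equivariance of each component, and `h` applies to each `σ` separately.
  have hfix : ∀ σ, ∃ m ∈ S σ, ∀ g, π g = 1 → conjugate Y Z D g m = m := by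
    intro σ
    obtain ⟨l, hl, l1, l2, l3⟩ := h (Y.V ◁ s ≫ mapEval π Y Z σ)
      (X.V ◁ t₂ ≫ mapEval π X Z σ) (Y.V ◁ t₁ ≫ mapEval π Y W σ)
      (fun g hg => by simpa only [hg, one_mul] using comp_eval_equivariant s g σ)
      (fun g hg => by simpa only [hg, one_mul] using comp_eval_equivariant t₂ g σ)
      (fun g hg => by simpa only [hg, one_mul] using comp_eval_equivariant t₁ g σ)
      (by rw [← comp_mapMapHom_eval_left, h₂, MonoidalCategory.whiskerLeft_comp, Category.assoc])
      (by rw [← comp_mapMapHom_eval_right, h₁, MonoidalCategory.whiskerLeft_comp, Category.assoc])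
      (by rw [← comp_mapMapHom_eval_right, ← h₃, comp_mapMapHom_eval_left])
    exact ⟨l, ⟨l1, l2, l3⟩, fun g hg => ((eq_conjugate_iff Y Z D g l l).2 (hl g hg)).symm⟩
  obtain ⟨m, hm, hm'⟩ := exists_equivariant_section π (conjugate Y Z D)
    (conjugate_mul Y Z D) S hS hfix
  have he := mapLift_eval m fun g σ => (eq_conjugate_iff Y Z D g _ _).1 (hm' g σ)
  refine ⟨mapLift m fun g σ => (eq_conjugate_iff Y Z D g _ _).1 (hm' g σ), ?_, ?_, ?_⟩
  · refine map_hom_ext fun σ => ?_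
    rw [MonoidalCategory.whiskerLeft_comp, Category.assoc, he]
    exact (hm σ).1
  · refine map_hom_ext fun σ => ?_
    rw [comp_mapMapHom_eval_right, he]
    exact (hm σ).2.2
  · refine map_hom_ext fun σ => ?_
    rw [comp_mapMapHom_eval_left, he]
    exact (hm σ).2.1

/-- Trivial fibrations are the morphisms with the right lifting property against cofibrations, and
the lifts required here need not be `Q`-equivariant. A map into the pullback splits into the two
components treated by `HasKernelLifting.exists_mapObj_lift`. -/
lemma trivialFibrations_pullbackHom {X Y Z W : Action E G} (i : X ⟶ Y) (p : Z ⟶ W)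
    (h : ∀ {C D : E} (k : C ⟶ D), Cofibration k → HasKernelLifting π i k p) :
    trivialFibrations E (pullbackHom π i p).hom := by
  rw [← cofibrations_rlp]
  intro C D k hk
  refine ⟨fun {s t} sq => ?_⟩
  -- The pullback is formed among objects with `Q`-action; the forgetful functor preserves it, so
  -- underlying maps into it are determined by their two projections.
  have hP := (IsPullback.of_hasPullback (mapMap π i (𝟙 W)) (mapMap π (𝟙 X) p)).map
    (Action.forget E Q)
  have e1 := congrArg Action.Hom.hom (pullback.lift_fst _ _ (mapMap_comm π i p))
  have e2 := congrArg Action.Hom.hom (pullback.lift_snd _ _ (mapMap_comm π i p))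
  have e3 := congrArg Action.Hom.hom (pullback.condition
    (f := mapMap π i (𝟙 W)) (g := mapMap π (𝟙 X) p))
  obtain ⟨l, l1, l2, l3⟩ := (h k ((cofibration_iff k).2 hk)).exists_mapObj_lift s
    (t ≫ (pullback.fst (mapMap π i (𝟙 W)) (mapMap π (𝟙 X) p)).hom)
    (t ≫ (pullback.snd (mapMap π i (𝟙 W)) (mapMap π (𝟙 X) p)).hom)
    ((congrArg (fun r => s ≫ r) e1).symm.trans ((Category.assoc _ _ _).symm.trans
      ((congrArg (fun r => r ≫ _) sq.w).trans (Category.assoc _ _ _))))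
    ((congrArg (fun r => s ≫ r) e2).symm.trans ((Category.assoc _ _ _).symm.trans
      ((congrArg (fun r => r ≫ _) sq.w).trans (Category.assoc _ _ _))))
    ((Category.assoc _ _ _).trans ((congrArg (fun r => t ≫ r) e3).trans
      (Category.assoc _ _ _).symm))
  exact ⟨⟨⟨l, l1, hP.hom_ext
    ((Category.assoc _ _ _).trans ((congrArg (fun r => l ≫ r) e1).trans l2))
    ((Category.assoc _ _ _).trans ((congrArg (fun r => l ≫ r) e2).trans l3))⟩⟩⟩

/-- This is one half of the adjunction: `a` is transposed to the family whose component at `σ` is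
`a` precomposed with the action of `σ` on `A`. Since `π g * σ` acts on `A` as `σ` followed by `π g`,
the equivariance of `a` gives that of the family. -/
lemma family_equivariant {Y Z : Action E G} {A : Action E Q} (a : Y.V ⊗ A.V ⟶ Z.V)
    (ha : ∀ g, (Y.ρ g ⊗ₘ A.ρ (π g)) ≫ a = a ≫ Z.ρ g) (g : G) (σ : Q) :
    Y.ρ g ▷ A.V ≫ Y.V ◁ A.ρ (π g * σ) ≫ a = (Y.V ◁ A.ρ σ ≫ a) ≫ Z.ρ g := by
  rw [ρ_mul, Category.assoc, ← ha, MonoidalCategory.whiskerLeft_comp,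
    MonoidalCategory.tensorHom_def, Category.assoc, Category.assoc, whisker_exchange_assoc]

/-- The family of morphisms associated to an equivariant morphism `Y ⊗ A ⟶ Z`. -/
def mapTranspose {Y Z : Action E G} {A : Action E Q} (a : Y.V ⊗ A.V ⟶ Z.V)
    (ha : ∀ g, (Y.ρ g ⊗ₘ A.ρ (π g)) ≫ a = a ≫ Z.ρ g) : A ⟶ mapAction π Y Z where
  hom := mapLift (fun σ => Y.V ◁ A.ρ σ ≫ a) (family_equivariant a ha)
  comm τ := map_hom_ext fun σ => by
    rw [MonoidalCategory.whiskerLeft_comp, Category.assoc, mapLift_eval]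
    refine Eq.trans ?_ ((congrArg (fun t => t ≫ _) (MonoidalCategory.whiskerLeft_comp _ _ _)).trans
      ((Category.assoc _ _ _).trans (congrArg _ (mapTranslate_eval τ σ)))).symm
    rw [mapLift_eval, ρ_mul, MonoidalCategory.whiskerLeft_comp, Category.assoc]

lemma mapTranspose_eval {Y Z : Action E G} {A : Action E Q} (a : Y.V ⊗ A.V ⟶ Z.V)
    (ha : ∀ g, (Y.ρ g ⊗ₘ A.ρ (π g)) ≫ a = a ≫ Z.ρ g) (σ : Q) :
    Y.V ◁ (mapTranspose a ha).hom ≫ mapEval π Y Z σ = Y.V ◁ A.ρ σ ≫ a :=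
  mapLift_eval _ (family_equivariant a ha) _

lemma whiskerLeft_ρ_one {A : Action E Q} {Y T : E} (a : Y ⊗ A.V ⟶ T) :
    Y ◁ A.ρ 1 ≫ a = a := by
  have h : A.ρ 1 = 𝟙 A.V := A.ρ.map_one
  rw [h, MonoidalCategory.whiskerLeft_id, Category.id_comp]

/-- The other half of the adjunction is evaluation at `1`. The `Q`-equivariance of `l` turns the
action of `π g` on `A` into translation of families, moving the evaluation point from `1` to `π g`;
the equivariance of families moves it back at the cost of `Z.ρ g`. -/
lemma eval_one_equivariant {Y Z : Action E G} {A : Action E Q} (l : A ⟶ mapAction π Y Z) (g : G) :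
    (Y.ρ g ⊗ₘ A.ρ (π g)) ≫ Y.V ◁ l.hom ≫ mapEval π Y Z 1 =
      (Y.V ◁ l.hom ≫ mapEval π Y Z 1) ≫ Z.ρ g := by
  have h1 := mapTranslate_eval (π := π) (Y := Y) (Z := Z) (π g) 1
  have h2 := comp_eval_equivariant (Y := Y) (Z := Z) (π := π) l.hom g (1 : Q)
  have h3 : A.ρ (π g) ≫ l.hom = l.hom ≫ mapTranslate π Y Z (π g) := l.comm (π g)
  rw [one_mul] at h1
  rw [mul_one] at h2
  rw [MonoidalCategory.tensorHom_def, Category.assoc, ← MonoidalCategory.whiskerLeft_comp_assoc,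
    h3, MonoidalCategory.whiskerLeft_comp_assoc, h1]
  exact h2

/-- An equivariant extension property for the pushout-product of a `G`-equivariant morphism `i` and
a `Q`-cofibration `f`. -/
lemma IsEquivariantCofibration.exists_lift {X Y Z W : Action E G} (i : X ⟶ Y) (p : Z ⟶ W)
    (h : ∀ {C D : E} (k : C ⟶ D), Cofibration k → HasKernelLifting π i k p)
    {A B : Action E Q} {f : A ⟶ B} (hf : IsEquivariantCofibration f)
    (a : Y.V ⊗ A.V ⟶ Z.V) (b : X.V ⊗ B.V ⟶ Z.V) (c : Y.V ⊗ B.V ⟶ W.V)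
    (ha : ∀ g, (Y.ρ g ⊗ₘ A.ρ (π g)) ≫ a = a ≫ Z.ρ g)
    (hb : ∀ g, (X.ρ g ⊗ₘ B.ρ (π g)) ≫ b = b ≫ Z.ρ g)
    (hc : ∀ g, (Y.ρ g ⊗ₘ B.ρ (π g)) ≫ c = c ≫ W.ρ g)
    (hab : i.hom ▷ A.V ≫ a = X.V ◁ f.hom ≫ b) (hac : a ≫ p.hom = Y.V ◁ f.hom ≫ c)
    (hbc : b ≫ p.hom = i.hom ▷ B.V ≫ c) :
    ∃ l : Y.V ⊗ B.V ⟶ Z.V, (∀ g, (Y.ρ g ⊗ₘ B.ρ (π g)) ≫ l = l ≫ Z.ρ g) ∧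
      Y.V ◁ f.hom ≫ l = a ∧ i.hom ▷ B.V ≫ l = b ∧ l ≫ p.hom = c := by
  have hl := hf _ (trivialFibrations_pullbackHom (π := π) i p h)
  have h3 : mapTranspose c hc ≫ mapMap π i (𝟙 W) = mapTranspose b hb ≫ mapMap π (𝟙 X) p := by
    refine Action.hom_ext _ _ (map_hom_ext fun σ => ?_)
    refine (comp_mapMapHom_eval_left (mapTranspose c hc).hom i σ).trans
      (Eq.trans ?_ (comp_mapMapHom_eval_right (mapTranspose b hb).hom p σ).symm)
    rw [mapTranspose_eval, mapTranspose_eval, Category.assoc, hbc, whisker_exchange_assoc]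
  -- The transposed lifting problem: `a` gives the map out of `A`, and the compatible pair `c`, `b`
  -- gives the map from `B` into the pullback.
  have sq : CommSq (mapTranspose a ha) f (pullbackHom π i p)
      (pullback.lift (mapTranspose c hc) (mapTranspose b hb) h3) := ⟨by
    refine pullback.hom_ext ?_ ?_
    · rw [pullbackHom, Category.assoc, Category.assoc, pullback.lift_fst, pullback.lift_fst]
      refine Action.hom_ext _ _ (map_hom_ext fun σ => ?_)
      refine (comp_mapMapHom_eval_right (mapTranspose a ha).hom p σ).trans ?_
      rw [mapTranspose_eval, Action.comp_hom, MonoidalCategory.whiskerLeft_comp, Category.assoc,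
        Category.assoc, hac]
      refine Eq.trans ?_ (congrArg (fun t => _ ≫ t) (mapTranspose_eval c hc σ)).symm
      rw [← MonoidalCategory.whiskerLeft_comp_assoc, f.comm,
        MonoidalCategory.whiskerLeft_comp_assoc]
    · rw [pullbackHom, Category.assoc, Category.assoc, pullback.lift_snd, pullback.lift_snd]
      refine Action.hom_ext _ _ (map_hom_ext fun σ => ?_)
      refine (comp_mapMapHom_eval_left (mapTranspose a ha).hom i σ).trans ?_
      rw [mapTranspose_eval, Action.comp_hom, MonoidalCategory.whiskerLeft_comp, Category.assoc]
      refine Eq.trans ?_ (congrArg (fun t => _ ≫ t) (mapTranspose_eval b hb σ)).symm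
      rw [← MonoidalCategory.whiskerLeft_comp_assoc, ← f.comm,
        MonoidalCategory.whiskerLeft_comp_assoc, ← hab, whisker_exchange_assoc]⟩
  have l1 : f ≫ sq.lift = mapTranspose a ha := sq.fac_left
  have l2 : sq.lift ≫ mapMap π (𝟙 Y) p = mapTranspose c hc := by
    have := congrArg (fun t => t ≫ pullback.fst _ _) sq.fac_right
    simpa only [pullbackHom, Category.assoc, pullback.lift_fst] using this
  have l3 : sq.lift ≫ mapMap π i (𝟙 Z) = mapTranspose b hb := by
    have := congrArg (fun t => t ≫ pullback.snd _ _) sq.fac_right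
    simpa only [pullbackHom, Category.assoc, pullback.lift_snd] using this
  -- Evaluation at `1` undoes the transposition, so the three identities satisfied by the lift
  -- become the three required ones.
  have m1 := congrArg (fun t => Y.V ◁ Action.Hom.hom t ≫ mapEval π Y Z 1) l1
  have m2 := congrArg (fun t => Y.V ◁ Action.Hom.hom t ≫ mapEval π Y W 1) l2
  have m3 := congrArg (fun t => X.V ◁ Action.Hom.hom t ≫ mapEval π X Z 1) l3
  refine ⟨Y.V ◁ sq.lift.hom ≫ mapEval π Y Z 1, eval_one_equivariant sq.lift, ?_, ?_, ?_⟩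
  · rw [← MonoidalCategory.whiskerLeft_comp_assoc]
    exact m1.trans ((mapTranspose_eval a ha 1).trans (whiskerLeft_ρ_one a))
  · exact (comp_mapMapHom_eval_left sq.lift.hom i 1).symm.trans (m3.trans
      ((mapTranspose_eval b hb 1).trans (whiskerLeft_ρ_one b)))
  · exact (comp_mapMapHom_eval_right sq.lift.hom p 1).symm.trans (m2.trans
      ((mapTranspose_eval c hc 1).trans (whiskerLeft_ρ_one c)))

/-- Let `x` be a `G`-equivariant arrow which is admissible for the kernel of `π : G →* Q`, and `y` a
`Q`-cofibration. Then the pushout-product of `x` and `y` is a `G`-cofibration. -/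
theorem IsAdmissible.isArrowCofibration_tensor (hj : ∀ g, π g = 1 ↔ g ∈ j.range)
    (hx : IsAdmissible ((Action.res _ j).obj x)) {y : Action (Arrow E) Q}
    (hy : IsArrowCofibration y) : IsArrowCofibration (x ⊗ (Action.res _ π).obj y) := by
  rw [isArrowCofibration_tensor_iff]
  intro Z W p hp a b c ha hb hc hab hac hbc
  exact hy.exists_lift (equivariantHom x) p (fun k hk => hx.hasKernelLifting hj k hk p hp)
    a b c ha hb hc hab hac hbc

end CoreLemma

/-! ### Closure properties of admissible arrows -/

noncomputable section Admissible
variable {E : Type u} [Category.{v} E] [ModelCategory E]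
variable {G K Q : Type} [Group G] [Group K] [Group Q]

lemma IsEquivariantCofibration.arrowAction {A B : Action E G} {f : A ⟶ B}
    (hf : IsEquivariantCofibration f) : IsArrowCofibration (arrowAction f) := by
  rw [isArrowCofibration_iff]
  intro Z W p hp a b ha hb w
  have hl := hf p hp
  let s : A ⟶ Z := ⟨a, ha⟩
  let t : B ⟶ W := ⟨b, hb⟩
  have sq : CommSq s f p t := ⟨Action.hom_ext _ _ w⟩
  exact ⟨sq.lift.hom, sq.lift.comm, congrArg Action.Hom.hom sq.fac_left,
    congrArg Action.Hom.hom sq.fac_right⟩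

/-- Over a trivial group every morphism is equivariant, and cofibrations are the morphisms with the
left lifting property against trivial fibrations. -/
lemma isArrowCofibration_of_subsingleton [Subsingleton G] (x : Action (Arrow E) G)
    (hx : Cofibration x.V.hom) : IsArrowCofibration x := by
  rw [isArrowCofibration_iff]
  intro Z W p hp a b ha hb w
  have h : (trivialFibrations E).llp x.V.hom := by
    rw [trivialFibrations_llp]
    exact (cofibration_iff _).1 hx
  have hl := h p.hom hp
  have sq : CommSq a x.V.hom p.hom b := ⟨w⟩
  refine ⟨sq.lift, fun g => ?_, sq.fac_left, sq.fac_right⟩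
  have hg : g = 1 := Subsingleton.elim _ _
  subst hg
  have h1 : x.ρ 1 = 𝟙 x.V := x.ρ.map_one
  have h2 : Z.ρ 1 = 𝟙 Z.V := Z.ρ.map_one
  rw [h1, h2, Category.comp_id]
  exact Category.id_comp _

variable [MonoidalCategory E] [SymmetricCategory E] [MonoidalClosed E]

/-- Apply the core theorem with `π` the identity and with `k`, carrying the trivial action, in the
role of the kernel-admissible arrow. The kernel is trivial, so admissibility of `k` over it is the
pushout-product axiom. -/
lemma IsArrowCofibration.isAdmissible [Finite G] (hE : PushoutProductAxiom E)
    {x : Action (Arrow E) G} (hx : IsArrowCofibration x) : IsAdmissible x := by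
  intro k hk
  have hk' : IsAdmissible ((Action.res _ (1 : Unit →* G)).obj (Action.trivial G k)) :=
    fun l hl => isArrowCofibration_of_subsingleton _ (hE.cofibration _ _ hk hl)
  refine IsArrowCofibration.of_iso (?_ : Action.trivial G k ⊗
    (Action.res _ (MonoidHom.id G)).obj x ≅ _) (hk'.isArrowCofibration_tensor (fun g => ?_) hx)
  · exact whiskerLeftIso _ ((Action.resId _).app x) ≪≫ β_ _ _
  · exact ⟨fun h => ⟨1, by rw [map_one]; exact h.symm⟩, by rintro ⟨_, rfl⟩; rfl⟩

/-- Restriction is compatible with tensor products. -/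
def resTensorIso {C : Type*} [Category* C] [MonoidalCategory C] (f : G →* Q) (y z : Action C Q) :
    (Action.res C f).obj (y ⊗ z) ≅ (Action.res C f).obj y ⊗ (Action.res C f).obj z :=
  Action.mkIso (Iso.refl _) fun _ => (Category.comp_id _).trans (Category.id_comp _).symm

/-- Absorb the test cofibration into the second factor: `(x ⊗ y) ⊗ k ≅ x ⊗ (y ⊗ k)`, and `y ⊗ k` is
a `Q`-cofibration by admissibility of `y`. -/
lemma IsAdmissible.tensor [Finite G] [Finite Q] {π : G →* Q} {j : K →* G}
    (hj : ∀ g, π g = 1 ↔ g ∈ j.range) {x : Action (Arrow E) G}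
    (hx : IsAdmissible ((Action.res _ j).obj x)) {y : Action (Arrow E) Q}
    (hy : IsAdmissible y) : IsAdmissible (x ⊗ (Action.res _ π).obj y) := by
  intro k hk
  refine (hx.isArrowCofibration_tensor hj (hy k hk)).of_iso ?_
  exact whiskerLeftIso x (resTensorIso π y (Action.trivial Q k)) ≪≫ (α_ _ _ _).symm

/-- The pushout-product of `∅ ⟶ I` with `k` is `k` itself, so cofibrancy of `I` plays no role. -/
lemma isAdmissible_unit [Subsingleton G] : IsAdmissible (𝟙_ (Action (Arrow E) G)) := by
  intro k hk
  exact (isArrowCofibration_of_subsingleton (Action.trivial G k) hk).of_iso (λ_ _).symm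

lemma nonempty_resTensorListIso {C : Type*} [Category* C] [MonoidalCategory C] {ι : Type}
    {H : ι → Type} [∀ i, Group (H i)] (X : ∀ i, Action C (H i)) (r : ∀ i, G →* H i) (j : K →* G)
    (l : List ι) :
    Nonempty ((Action.res C j).obj (tensorList (fun i => (Action.res C (r i)).obj (X i)) l) ≅
      tensorList (fun i => (Action.res C ((r i).comp j)).obj (X i)) l) := by
  induction l with
  | nil => exact ⟨Action.mkIso (Iso.refl _) fun _ =>
      (Category.comp_id _).trans (Category.id_comp _).symm⟩
  | cons a l ih =>
    obtain ⟨e⟩ := ih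
    exact ⟨resTensorIso j _ _ ≪≫ ((Action.resComp C j (r a)).app (X a) ⊗ᵢ e)⟩

/-- Tensor products of admissible arrows are admissible for groups which embed into the product of
the groups acting on the factors. -/
lemma isAdmissible_tensorList {ι : Type} {H : ι → Type} [∀ i, Group (H i)] [∀ i, Finite (H i)]
    {X : ∀ i, Action (Arrow E) (H i)} (hX : ∀ i, IsAdmissible (X i)) (l : List ι) :
    ∀ {G : Type} [Group G] [Finite G] (r : ∀ i, G →* H i),
      (∀ g, (∀ i ∈ l, r i g = 1) → g = 1) →
      IsAdmissible (tensorList (fun i => (Action.res _ (r i)).obj (X i)) l) := by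
  induction l with
  | nil =>
    intro G _ _ r hr
    -- Over the empty list the joint injectivity of the `r i` forces `G` to be trivial.
    have : Subsingleton G := ⟨fun g h => (hr g (by simp)).trans (hr h (by simp)).symm⟩
    exact isAdmissible_unit
  | cons a l ih =>
    intro G _ _ r hr
    -- On the kernel of `r a` the remaining `r i` are still jointly injective, so the induction
    -- hypothesis, which holds for all groups, makes the tail admissible for this kernel.
    -- `IsAdmissible.tensor` with `π = r a` then adds the factor `X a`.
    obtain ⟨e⟩ := nonempty_resTensorListIso X r (r a).ker.subtype l
    have h1 := ih (fun i => (r i).comp (r a).ker.subtype) fun g hg => Subtype.ext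
      (hr g fun i hi => by
        rcases List.mem_cons.1 hi with rfl | hi
        · exact g.2
        · exact hg i hi)
    exact ((h1.of_iso e.symm).tensor (π := r a) (fun g => by
      rw [Subgroup.range_subtype, MonoidHom.mem_ker]) (hX a)).of_iso (β_ _ _)

end Admissible

/-! ### Tensor products of lists of actions -/

noncomputable section TensorActions
variable {C : Type u} [Category.{v} C] [MonoidalCategory C] {α : Type w}

/-- The tensor product of a list of morphisms, without relabelling. -/
def listMap {X Y : α → C} (f : ∀ a, X a ⟶ Y a) : (l : List α) → (tensorList X l ⟶ tensorList Y l)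
  | [] => 𝟙 _
  | a :: l => f a ⊗ₘ listMap f l

lemma tensorHom_comp_eqToHom {A A' L L' M : C} (f : A ⟶ A') {m : L ⟶ M} {l : L ⟶ L'} (e : L' = M)
    (h : m = l ≫ eqToHom e) (e' : A' ⊗ L' = A' ⊗ M) :
    (f ⊗ₘ m) = (f ⊗ₘ l) ≫ eqToHom e' := by
  subst e
  simp [h]

/-- The underlying object of a tensor product of actions. -/
def tensorListVIso {G : Type*} [Monoid G] (X : α → Action C G) :
    (l : List α) → ((tensorList X l).V ≅ tensorList (fun a => (X a).V) l)
  | [] => Iso.refl _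
  | a :: l => whiskerLeftIso (X a).V (tensorListVIso X l)

lemma tensorListVIso_equivariant {G : Type*} [Monoid G] (X : α → Action C G) (g : G)
    (l : List α) :
    (tensorList X l).ρ g ≫ (tensorListVIso X l).hom =
      (tensorListVIso X l).hom ≫ listMap (fun a => (X a).ρ g) l := by
  induction l with
  | nil => rfl
  | cons a l ih =>
    change ((X a).ρ g ⊗ₘ (tensorList X l).ρ g) ≫ (X a).V ◁ (tensorListVIso X l).hom =
      (X a).V ◁ (tensorListVIso X l).hom ≫ ((X a).ρ g ⊗ₘ listMap (fun a => (X a).ρ g) l)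
    rw [← id_tensorHom, tensorHom_comp_tensorHom, tensorHom_comp_tensorHom, ih, Category.comp_id,
      Category.id_comp]

variable [SymmetricCategory C]

/-- The list mapped by the identity permutation equals the original list only propositionally; the
resulting `eqToHom` is absorbed by `permIso_cast`. -/
lemma tensorPerm_refl {n : ℕ} {X Y : Fin n → C} (f : ∀ i, X i ⟶ Y i) :
    tensorPerm (X := X) (Y := Y) (Equiv.refl _) f = listMap f (List.finRange n) := by
  have h : ∀ l : List (Fin n), mapList (X := X) (Y := Y) (Equiv.refl (Fin n)) f l =
      listMap f l ≫ eqToHom (congrArg (tensorList Y) (List.map_id l).symm) := by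
    intro l
    induction l with
    | nil => exact (Category.id_comp _).symm
    | cons a l ih =>
      exact tensorHom_comp_eqToHom (f a) _ ih (congrArg (fun t => Y a ⊗ tensorList Y t) (List.map_id l).symm)
  refine (congrArg (fun t => t ≫ _) (h _)).trans ((Category.assoc _ _ _).trans ?_)
  refine (congrArg (fun t => _ ≫ t) (permIso_cast (List.map_id _).symm
    (finRange_map_perm (Equiv.refl _)) (.refl _))).trans ?_
  rw [permIso_refl (List.nodup_finRange n)]
  exact Category.comp_id _

end TensorActions

/-! ### Automorphism groups of trees and their action on the branches -/

namespace ColouredTree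

/-- Finiteness of the automorphism groups is what allows `mapObj` to be built from finite limits. -/
instance finite_iso (S T : ColouredTree) : Finite (Iso S T) := by
  induction S generalizing T with
  | leaf =>
    refine Finite.of_injective (β := Unit) (fun _ => ()) ?_
    rintro ⟨⟩ ⟨⟩ _
    rfl
  | node c n s ih =>
    cases T with
    | leaf => exact Finite.of_injective (β := Empty) nofun nofun
    | node d m t =>
      by_cases h : c = d ∧ n = m
      · obtain ⟨rfl, rfl⟩ := h
        let f : (Σ σ : Equiv.Perm (Fin n), ∀ i, Iso (s i) (t (σ i))) →
            Iso (.node c n s) (.node c n t) := fun a => .node c a.1 a.2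
        have : ∀ i, ∀ k, Finite (Iso (s i) (t k)) := fun i k => ih i _
        refine Finite.of_surjective f ?_
        rintro ⟨⟩
        exact ⟨⟨_, _⟩, rfl⟩
      · refine Finite.of_injective (β := Empty) (fun φ => ?_) ?_
        · cases φ
          exact (h ⟨rfl, rfl⟩).elim
        · intro φ
          cases φ
          exact (h ⟨rfl, rfl⟩).elim

instance finite_aut (T : ColouredTree) : Finite (Aut T) :=
  Finite.of_injective (β := Iso T T) (fun g => g.hom) fun _ _ h => Aut.ext h

instance subsingleton_aut_leaf : Subsingleton (Aut leaf) := by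
  refine ⟨fun g h => Aut.ext ?_⟩
  have : ∀ φ ψ : Iso leaf leaf, φ = ψ := by
    rintro ⟨⟩ ⟨⟩
    rfl
  exact this _ _

/-- The permutation of the inputs of the root induced by an isomorphism of trees. -/
def Iso.rootPerm {c : Bool} {n : ℕ} {s t : Fin n → ColouredTree} :
    Iso (.node c n s) (.node c n t) → Equiv.Perm (Fin n)
  | .node _ σ _ => σ

lemma Iso.rootPerm_comp {c : Bool} {n : ℕ} {r s t : Fin n → ColouredTree}
    (φ : Iso (.node c n r) (.node c n s)) (ψ : Iso (.node c n s) (.node c n t)) :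
    (φ.comp ψ).rootPerm = φ.rootPerm.trans ψ.rootPerm := by
  cases φ; cases ψ; rfl

/-- The action of the automorphisms of a tree on the inputs of the root. -/
def rootPermHom (c : Bool) (n : ℕ) (s : Fin n → ColouredTree) :
    Aut (node c n s) →* Equiv.Perm (Fin n) where
  toFun g := Iso.rootPerm g.hom
  map_one' := rfl
  map_mul' g h := Iso.rootPerm_comp h.hom g.hom

/-- The automorphisms of a tree given by automorphisms of the branches. -/
def branchAut (c : Bool) (n : ℕ) (s : Fin n → ColouredTree) :
    (∀ i, Aut (s i)) →* Aut (node c n s) where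
  toFun φ := (Groupoid.isoEquivHom _ _).symm (Iso.node c (Equiv.refl _) fun i => (φ i).hom)
  map_one' := Aut.ext rfl
  map_mul' _ _ := Aut.ext rfl

/-- This identifies the kernel of the action on the root inputs with the product of the automorphism
groups of the branches, in the form of the hypothesis `hj` of the core theorem. -/
lemma rootPermHom_eq_one_iff (c : Bool) (n : ℕ) (s : Fin n → ColouredTree)
    (g : Aut (node c n s)) : rootPermHom c n s g = 1 ↔ g ∈ (branchAut c n s).range := by
  constructor
  · intro hg
    -- Stated for a free variable `φ` of type `Iso`, so that it can be destructed and its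
    -- permutation replaced by the identity.
    have h : ∀ φ : Iso (node c n s) (node c n s), φ.rootPerm = Equiv.refl _ →
        ∃ ψ : ∀ i, Iso (s i) (s i), φ = Iso.node c (Equiv.refl _) ψ := by
      intro φ hφ
      cases φ with
      | node _ σ φ =>
        change σ = _ at hφ
        subst hφ
        exact ⟨φ, rfl⟩
    obtain ⟨ψ, hψ⟩ := h g.hom hg
    exact ⟨fun i => (Groupoid.isoEquivHom _ _).symm (ψ i), Aut.ext hψ.symm⟩
  · rintro ⟨φ, rfl⟩
    rfl

noncomputable section Branches
variable {C : Type u} [Category.{v} C] [MonoidalCategory C] [SymmetricCategory C]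
  (L : Bool → ∀ n : ℕ, Action C (Equiv.Perm (Fin n)))

/-- The morphism induced by an isomorphism of trees on the tensor product of the branches at the
root. -/
def branchMap {c : Bool} {n : ℕ} {s t : Fin n → ColouredTree} :
    Iso (.node c n s) (.node c n t) →
      (tensorFin (fun i => labelObj L (s i)) ⟶ tensorFin (fun i => labelObj L (t i)))
  | .node _ σ φ => tensorPerm σ fun i => labelMap L (φ i)

lemma labelMap_eq {c : Bool} {n : ℕ} {s t : Fin n → ColouredTree}
    (φ : Iso (.node c n s) (.node c n t)) :
    labelMap L φ = ((L c n).ρ φ.rootPerm ⊗ₘ branchMap L φ) := by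
  cases φ; rfl

lemma branchMap_refl {c : Bool} {n : ℕ} {s : Fin n → ColouredTree} (φ : ∀ i, Iso (s i) (s i)) :
    branchMap L (.node c (Equiv.refl _) φ) =
      listMap (fun i => labelMap L (φ i)) (List.finRange n) :=
  tensorPerm_refl (X := fun i => labelObj L (s i)) (Y := fun i => labelObj L (s i))
    fun i => labelMap L (φ i)

lemma branchMap_id {c : Bool} {n : ℕ} (s : Fin n → ColouredTree) :
    branchMap L (Iso.id (.node c n s)) = 𝟙 _ := by
  refine Eq.trans ?_ (tensorPerm_id (X := fun i => labelObj L (s i)))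
  exact congrArg (tensorPerm (X := fun i => labelObj L (s i)) (Y := fun i => labelObj L (s i))
    (Equiv.refl _)) (funext fun i => (labelling L).map_id (s i))

lemma branchMap_comp {c : Bool} {n : ℕ} {r s t : Fin n → ColouredTree}
    (φ : Iso (.node c n r) (.node c n s)) (ψ : Iso (.node c n s) (.node c n t)) :
    branchMap L (φ.comp ψ) = branchMap L φ ≫ branchMap L ψ := by
  cases φ with
  | node _ σ φ =>
    cases ψ with
    | node _ τ ψ =>
      refine Eq.trans ?_ (tensorPerm_comp σ τ _ _).symm
      exact congrArg (tensorPerm (X := fun i => labelObj L (r i)) (Y := fun i => labelObj L (t i))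
        (σ.trans τ)) (funext fun i => (labelling L).map_comp (φ i) (ψ (σ i)))

/-- The tensor product of the branches at the root with the action of the automorphism group. -/
def branchAction (c : Bool) (n : ℕ) (s : Fin n → ColouredTree) : Action C (Aut (node c n s)) where
  V := tensorFin fun i => labelObj L (s i)
  ρ :=
    { toFun := fun g => branchMap L g.hom
      map_one' := branchMap_id L s
      map_mul' := fun g h => branchMap_comp L h.hom g.hom }

/-- A tree is the tensor product of its root and its branches. -/
def autActionNodeIso (c : Bool) (n : ℕ) (s : Fin n → ColouredTree) :
    (Action.res C (rootPermHom c n s)).obj (L c n) ⊗ branchAction L c n s ≅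
      autAction (labelling L) (node c n s) :=
  Action.mkIso (CategoryTheory.Iso.refl _) fun g => (Category.comp_id _).trans
    ((labelMap_eq L g.hom).symm.trans (Category.id_comp _).symm)

/-- The action of the automorphism groups of the branches on their tensor product. -/
def resBranchActionIso (c : Bool) (n : ℕ) (s : Fin n → ColouredTree) :
    tensorList (fun i => (Action.res C (Pi.evalMonoidHom (fun i => Aut (s i)) i)).obj
      (autAction (labelling L) (s i))) (List.finRange n) ≅
    (Action.res C (branchAut c n s)).obj (branchAction L c n s) :=
  Action.mkIso (tensorListVIso _ _) fun g => (tensorListVIso_equivariant _ g _).trans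
    (congrArg (fun t => _ ≫ t) (branchMap_refl L (c := c) (s := s) fun i => (g i).hom).symm)

end Branches
end ColouredTree

/-! ### Induction over trees -/

noncomputable section Main
open ColouredTree
variable {E : Type u} [Category.{v} E] [MonoidalCategory E] [SymmetricCategory E]
  [MonoidalClosed E] [ModelCategory E]

section
variable (L : Bool → Collection (Arrow E))

/-- The core theorem for `G = Aut T`, `Q = Σₙ` and `K = ∏ Aut Tᵢ`. The evaluations of `K` at its
factors are jointly injective, so the product of the branches is admissible over `K`. Only
admissibility of the branches enters, which leaves room for trivial branches over a non-cofibrant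
unit. -/
lemma isArrowCofibration_node (hL : ∀ c n, IsArrowCofibration (L c n)) (c : Bool) (n : ℕ)
    (s : Fin n → ColouredTree) (hs : ∀ i, IsAdmissible (autAction (labelling L) (s i))) :
    IsArrowCofibration (autAction (labelling L) (node c n s)) := by
  have h1 : IsAdmissible ((Action.res _ (branchAut c n s)).obj (branchAction L c n s)) :=
    (isAdmissible_tensorList hs (List.finRange n)
      (Pi.evalMonoidHom fun i => Aut (s i)) fun g hg =>
        funext fun i => hg i (List.mem_finRange i)).of_iso (resBranchActionIso L c n s)
  exact (h1.isArrowCofibration_tensor (rootPermHom_eq_one_iff c n s) (hL c n)).of_iso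
    (β_ _ _ ≪≫ autActionNodeIso L c n s)

lemma isAdmissible_autAction (hE : PushoutProductAxiom E)
    (hL : ∀ c n, IsArrowCofibration (L c n)) (T : ColouredTree) :
    IsAdmissible (autAction (labelling L) T) := by
  induction T with
  | leaf =>
    refine isAdmissible_unit.of_iso (Action.mkIso (M := 𝟙_ (Action (Arrow E) (Aut leaf)))
      (N := autAction (labelling L) leaf) (Iso.refl (𝟙_ (Arrow E))) fun g => ?_)
    rw [Subsingleton.elim g 1]
    exact (Category.comp_id _).trans (((autAction (labelling L) leaf).ρ.map_one).symm.trans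
      (Category.id_comp _).symm)
  | node c n s ih => exact (isArrowCofibration_node L hL c n s ih).isAdmissible hE
end

variable {K₁ K₂ : Collection E} (η : unitCollection E ⟶ K₁) (u : K₁ ⟶ K₂)

/-- The inclusion is the equivariant arrow of the labelling followed by the isomorphism `targetIso`,
which is itself equivariant, and lifting properties survive composition with isomorphisms. -/
lemma isEquivariantCofibration_uStarInclusion (T : ColouredTree)
    (h : IsArrowCofibration (autAction (arrowLabelling η u) T)) :
    IsEquivariantCofibration (uStarInclusion η u T) := by
  let e : targetAction (autAction (arrowLabelling η u) T) ≅ uObj K₁ K₂ T :=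
    Action.mkIso (targetIso η u T) fun g =>
      rightLabelIso_naturality (arrowLabels η u) (labels K₁ K₂) _
        (fun c n σ => by
          cases c <;> exact (Category.comp_id _).trans (Category.id_comp _).symm) g.hom
  intro Z W p hp
  have := h p hp
  have h2 : HasLiftingProperty (equivariantHom (autAction (arrowLabelling η u) T) ≫ e.hom) p :=
    inferInstance
  exact h2

end Main
end OperadTree

open OperadTree HomotopicalAlgebra
theorem mainTheorem11 {E : Type u} [Category.{v} E] [MonoidalCategory E] [SymmetricCategory E]
    [MonoidalClosed E] [ModelCategory E] (hE : PushoutProductAxiom E)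
    {K₁ K₂ : Collection E} (η : unitCollection E ⟶ K₁) (u : K₁ ⟶ K₂)
    (hη : IsCollectionCofibration η) (hu : IsCollectionCofibration u)
    (T : ColouredTree) (hT : T ≠ ColouredTree.leaf ∨ IsCofibrant (𝟙_ E)) :
    IsEquivariantCofibration (uStarInclusion η u T) := by
  have hL : ∀ c n, IsArrowCofibration (arrowLabels η u c n) := by
    rintro (_ | _) n
    exacts [(hη n).arrowAction, (hu n).arrowAction]
  apply isEquivariantCofibration_uStarInclusion
  cases T with
  -- The trivial tree has trivial automorphism group, and its arrow `∅ ⟶ I` is a cofibration exactly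
  -- when `I` is cofibrant.
  | leaf => exact isArrowCofibration_of_subsingleton _ (hT.resolve_left fun h => h rfl)
  | node c n s =>
    exact isArrowCofibration_node _ hL c n s fun i => isAdmissible_autAction _ hE hL (s i)
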